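/- Let $(\Omega,\Sigma,\mu)$ be a measure space with the direct sum property, i.e. there is a family $\{\Omega_i\}_{i\in J}\subset\Sigma$ with $0<\mu(\Omega_i)<\infty$ such that for every $A\in\Sigma$ with $\mu(A)<\infty$ there are a countable $J_0\subset J$ and a null set $B$ with $A=\bigcup_{i\in J_0}(A\cap\Omega_i)\cup B$. Let $L^\infty(\Omega)$ be the algebra of classes of essentially bounded complex measurable functions and $\nabla$ the Boolean algebra of its idempotents. A partition of unity is a family of pairwise disjoint elements of $\nabla$ (zero allowed) with supremum $\mathbf 1$ in $\nabla$. Let $X$ be a Hilbert–Kaplansky module over $L^\infty(\Omega)$: a unitary $L^\infty(\Omega)$-module with an $L^\infty(\Omega)$-valued inner product $\langle\cdot,\cdot\rangle$ (positive definite, Hermitian, $L^\infty(\Omega)$-linear in the first variable), complete for the norm $\|\xi\|_\infty=\sqrt{\|\langle\xi,\xi\rangle\|_{L^\infty(\Omega)}}$, and such that for every partition of unity $\{\pi_i\}_{i\in I}$: (1) if $\pi_i\xi=0$ for all $i$, then $\xi=0$; (2) for every norm-bounded family $\{\xi_i\}_{i\in I}$ in $X$ there is $\xi\in X$ with $\pi_i\xi=\pi_i\xi_i$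 for all $i$. Such a $\xi$ (which is unique) is the mixing of $\{\xi_i\}$ along $\{\pi_i\}$. Put $\|\xi\|=\sqrt{\langle\xi,\xi\rangle}\in L^\infty(\Omega)$ and $(\xi\otimes\eta)(\zeta)=\langle\zeta,\eta\rangle\xi$. A set $C\subset X$ is cyclic if it equals the set of all mixings in $X$ of families taken from $C$. A cyclic subsequence of a sequence $(\xi_n)_{n\in\mathbb N}$ is a sequence $(\eta_k)_{k\in\mathbb N}$ such that there are partitions of unity $(\nu_k(n))_{n\in\mathbb N}$, $k\in\mathbb N$, for which $\nu_k(m)\wedge\nu_{k+1}(n)\neq0$ implies $m<n$, and $\eta_k$ is the mixing of $(\xi_n)_n$ along $\nu_k$. A set $C$ is cyclically compact if it is cyclic and every sequence in $C$ has a cyclic subsequence converging in $\|\cdot\|_\infty$ to an element of $C$. An $L^\infty(\Omega)$-linear operator $T:X\to X$ is cyclically compact if the image of every bounded set is contained in a cyclically compact set, and self-adjoint if $\langle T\xi,\eta\rangle=\langle\xi,T\eta\rangle$ for all $\xi,\eta\in X$. For $e_n\in L^\infty(\Omega)$, write $e_n\downarrow0$ if $(e_n)$ is decreasing with infimum $0$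 in $L^\infty(\Omega)$. A series $\sum_n u_n$ of $L^\infty(\Omega)$-linear operators on $X$ has order sum $S$ if there are $e_N\downarrow0$ with $\|(S-\sum_{n\le N}u_n)\zeta\|\le e_N\|\zeta\|$ for all $N\ge 0$ and $\zeta\in X$. **Theorem.** Let $T$ be a self-adjoint cyclically compact operator on $X$. Then there are a partition of unity $\{\pi_0,\pi_1,\dots,\pi_k,\dots,\pi_\infty\}$ in $\nabla$ and, for each $k=1,2,\dots,\infty$, elements $\xi_{k,n}\in\pi_kX$ and $f_{k,n}\in\pi_kL^\infty(\Omega)$ ($1\le n\le k$, $n<\infty$), with $\{\xi_{k,n}\}_n$ orthonormal in $\pi_kX$, i.e. $\langle\xi_{k,n},\xi_{k,n}\rangle=\pi_k$ and $\langle\xi_{k,m},\xi_{k,n}\rangle=0$ for $m\ne n$, such that 1. $\pi_0T=0$; 2. $\pi_\infty|f_{\infty,n}|\downarrow0$; 3. $$T=\pi_\infty\sum_{n=1}^\infty f_{\infty,n}\,\xi_{\infty,n}\otimes\xi_{\infty,n}+\sum_{k=1}^\infty\pi_k\sum_{n=1}^kf_{k,n}\,\xi_{k,n}\otimes\xi_{k,n},$$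 where both infinite series are order sums in the sense above. -/

import Mathlib

open MeasureTheory
open scoped ENNReal ComplexOrder

universe u v

noncomputable section

namespace CyclicSpectral

variable {Ω : Type u} [MeasurableSpace Ω]

/-! ### The algebra `L^∞(Ω)` -/

/-- The space `L^∞(Ω)` of a.e.-classes of essentially bounded complex measurable functions, with
Mathlib's essential-supremum norm `‖f‖`. The order used below is the a.e. order (for the order of
`ℂ` in which `z ≤ w` means that `w - z` is a nonnegative real). -/
abbrev LInfty (μ : Measure Ω) : Type u := Lp ℂ ∞ μ

namespace LInfty

variable {μ : Measure Ω}

instance instOne : One (LInfty μ) := ⟨(memLp_top_const (1 : ℂ)).toLp _⟩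

instance instMul : Mul (LInfty μ) :=
  ⟨fun f g => ((Lp.memLp g).mul (Lp.memLp f) : MemLp (⇑f * ⇑g) ∞ μ).toLp _⟩

theorem coeFn_one : ⇑(1 : LInfty μ) =ᵐ[μ] fun _ => (1 : ℂ) :=
  (memLp_top_const (1 : ℂ)).coeFn_toLp

theorem coeFn_mul (f g : LInfty μ) : ⇑(f * g) =ᵐ[μ] fun ω => f ω * g ω :=
  ((Lp.memLp g).mul (Lp.memLp f) : MemLp (⇑f * ⇑g) ∞ μ).coeFn_toLp

theorem one_mul' (f : LInfty μ) : 1 * f = f := by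
  apply Lp.ext
  filter_upwards [coeFn_mul 1 f, coeFn_one (μ := μ)] with ω h1 h2
  rw [h1, h2, one_mul]

theorem mul_comm' (f g : LInfty μ) : f * g = g * f := by
  apply Lp.ext
  filter_upwards [coeFn_mul f g, coeFn_mul g f] with ω h1 h2
  rw [h1, h2, mul_comm]

theorem mul_assoc' (f g h : LInfty μ) : f * g * h = f * (g * h) := by
  apply Lp.ext
  filter_upwards [coeFn_mul (f * g) h, coeFn_mul f g, coeFn_mul f (g * h), coeFn_mul g h]
    with ω h1 h2 h3 h4
  rw [h1, h2, h3, h4, mul_assoc]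

theorem mul_add' (f g h : LInfty μ) : f * (g + h) = f * g + f * h := by
  apply Lp.ext
  filter_upwards [coeFn_mul f (g + h), Lp.coeFn_add g h, coeFn_mul f g, coeFn_mul f h,
    Lp.coeFn_add (f * g) (f * h)] with ω h1 h2 h3 h4 h5
  rw [h1, h2, h5, Pi.add_apply, Pi.add_apply, h3, h4, mul_add]

theorem mul_zero' (f : LInfty μ) : f * 0 = 0 := by
  apply Lp.ext
  filter_upwards [coeFn_mul f 0, Lp.coeFn_zero ℂ ∞ μ] with ω h1 h2
  rw [h1, h2]
  simp

/-- `L^∞(Ω)` is a commutative ring under the pointwise a.e. operations. -/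
instance instCommRing : CommRing (LInfty μ) where
  __ := (inferInstance : AddCommGroup (LInfty μ))
  mul := (· * ·)
  one := 1
  mul_assoc := mul_assoc'
  one_mul := one_mul'
  mul_one f := by rw [mul_comm', one_mul']
  left_distrib := mul_add'
  right_distrib f g h := by rw [mul_comm', mul_add', mul_comm' h f, mul_comm' h g]
  zero_mul f := by rw [mul_comm', mul_zero']
  mul_zero := mul_zero'
  mul_comm := mul_comm'

theorem memLp_comp (g : C(ℂ, ℂ)) (f : LInfty μ) : MemLp (fun ω => g (f ω)) ∞ μ := by
  obtain ⟨C, hC⟩ := (isCompact_closedBall (0 : ℂ) ‖f‖).exists_bound_of_continuousOn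
    g.continuous.continuousOn
  refine memLp_top_of_bound
    (g.continuous.comp_aestronglyMeasurable (Lp.aestronglyMeasurable f)) C ?_
  have h : ∀ᵐ ω ∂μ, ‖f ω‖ ≤ ‖f‖ := by
    have h2 := (Lp.memLp f).eLpNorm_lt_top.ne
    filter_upwards [ae_le_eLpNormEssSup (f := ⇑f) (μ := μ)] with ω hω
    rw [Lp.norm_def, eLpNorm_exponent_top] at *
    rw [← toReal_enorm]
    exact ENNReal.toReal_mono h2 hω
  filter_upwards [h] with ω hω
  exact hC _ (by simpa using hω)

/-- The class `g ∘ f ∈ L^∞(Ω)` for a continuous function `g` on `ℂ` and `f ∈ L^∞(Ω)`. -/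
def comp (g : C(ℂ, ℂ)) (f : LInfty μ) : LInfty μ := (memLp_comp g f).toLp _

/-- The modulus `|f|`. -/
def abs (f : LInfty μ) : LInfty μ := comp ⟨fun z => ((‖z‖ : ℝ) : ℂ), by fun_prop⟩ f

/-- The square root `√f`; only used for `f ≥ 0`. -/
def sqrt (f : LInfty μ) : LInfty μ := comp ⟨fun z => ((Real.sqrt z.re : ℝ) : ℂ), by fun_prop⟩ f

/-- `e_n ↓ 0`: the sequence is decreasing and its infimum in `L^∞(Ω)` is `0`. -/
def DecreasesToZero (e : ℕ → LInfty μ) : Prop :=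
  Antitone e ∧ IsGLB (Set.range e) 0

/-- A partition of unity in the Boolean algebra `∇` of idempotents of `L^∞(Ω)` (ordered by
`π ≤ ρ ↔ π ρ = π`): pairwise disjoint idempotents whose least upper bound in `∇` is `1`. -/
def IsPartitionOfUnity {I : Type*} (π : I → LInfty μ) : Prop :=
  (∀ i, IsIdempotentElem (π i)) ∧ (∀ i j, i ≠ j → π i * π j = 0) ∧
    ∀ ρ : LInfty μ, IsIdempotentElem ρ → (∀ i, π i * ρ = π i) → ρ = 1

end LInfty

open LInfty

/-- The direct sum property of a measure: there is a family of measurable sets of positive finite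
measure such that every measurable set of finite measure is, up to a null set, covered by
countably many members of the family. -/
def HasDirectSumProperty (μ : Measure Ω) : Prop :=
  ∃ 𝒪 : Set (Set Ω), (∀ U ∈ 𝒪, MeasurableSet U ∧ 0 < μ U ∧ μ U < ∞) ∧
    ∀ A : Set Ω, MeasurableSet A → μ A < ∞ →
      ∃ 𝒥 ⊆ 𝒪, 𝒥.Countable ∧ ∃ B : Set Ω, μ B = 0 ∧ A = (⋃ U ∈ 𝒥, A ∩ U) ∪ B

/-! ### Hilbert–Kaplansky modules -/

/-- An `L^∞(Ω)`-valued inner product on a unitary `L^∞(Ω)`-module (linear in the first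
variable). -/
class LInftyInner (μ : Measure Ω) (X : Type v) [AddCommGroup X] [Module (LInfty μ) X] where
  ip : X → X → LInfty μ
  ip_self_nonneg : ∀ ξ, 0 ≤ ip ξ ξ
  ip_self_eq_zero : ∀ ξ, ip ξ ξ = 0 ↔ ξ = 0
  ip_conj : ∀ ξ η, ip ξ η = star (ip η ξ)
  ip_smul_left : ∀ (a : LInfty μ) ξ η, ip (a • ξ) η = a * ip ξ η
  ip_add_left : ∀ ξ η ζ, ip (ξ + η) ζ = ip ξ ζ + ip η ζ

section Inner

variable (μ : Measure Ω) {X : Type v} [AddCommGroup X] [Module (LInfty μ) X] [LInftyInner μ X]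

/-- The inner product `⟨ξ, η⟩ ∈ L^∞(Ω)`. -/
def inner (ξ η : X) : LInfty μ := LInftyInner.ip ξ η

/-- The real-valued norm `‖ξ‖_∞ = √‖⟨ξ, ξ⟩‖`. -/
def normInf (ξ : X) : ℝ := Real.sqrt ‖inner μ ξ ξ‖

/-- The vector norm `‖ξ‖ = √⟨ξ, ξ⟩ ∈ L^∞(Ω)`. -/
def vnorm (ξ : X) : LInfty μ := LInfty.sqrt (inner μ ξ ξ)

/-- Convergence of a sequence in the norm `‖·‖_∞`. -/
def NormConverges (s : ℕ → X) (ξ : X) : Prop :=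
  ∀ ε : ℝ, 0 < ε → ∃ N : ℕ, ∀ n ≥ N, normInf μ (s n - ξ) < ε

end Inner

/-- A Hilbert–Kaplansky module over `L^∞(Ω)`: it is complete for `‖·‖_∞`, an element annihilated
by a partition of unity is zero, and norm-bounded families can be mixed along partitions of
unity. -/
class HilbertKaplanskyModule (μ : Measure Ω) (X : Type v) [AddCommGroup X]
    [Module (LInfty μ) X] [LInftyInner μ X] : Prop where
  complete : ∀ s : ℕ → X,
    (∀ ε : ℝ, 0 < ε → ∃ N : ℕ, ∀ m ≥ N, ∀ n ≥ N, normInf μ (s m - s n) < ε) →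
      ∃ ξ : X, NormConverges μ s ξ
  eq_zero_of_partition : ∀ (I : Type u) (π : I → LInfty μ) (ξ : X),
    IsPartitionOfUnity π → (∀ i, π i • ξ = 0) → ξ = 0
  exists_mixing : ∀ (I : Type u) (π : I → LInfty μ) (s : I → X),
    IsPartitionOfUnity π → (∃ M : ℝ, ∀ i, normInf μ (s i) ≤ M) →
      ∃ ξ : X, ∀ i, π i • ξ = π i • s i

section Operators

variable (μ : Measure Ω) {X : Type v} [AddCommGroup X] [Module (LInfty μ) X]

/-- `mix(C)`: all mixings in `X` of families taken from `C`. -/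
def mix (C : Set X) : Set X :=
  {ξ | ∃ (I : Type u) (π : I → LInfty μ) (s : I → X),
    IsPartitionOfUnity π ∧ (∀ i, s i ∈ C) ∧ ∀ i, π i • ξ = π i • s i}

/-- A set is cyclic if it coincides with its set of mixings. -/
def IsCyclic (C : Set X) : Prop := C = mix μ C

/-- `η` is a cyclic subsequence of `s`: for partitions of unity `ν_0 ≪ ν_1 ≪ …` indexed by `ℕ`,
`η_k` is the mixing of `(s_n)` along `(ν_k(n))`. Here `ν ≪ ν'` means that
`ν(m) ∧ ν'(n) ≠ 0` implies `m < n`. -/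
def IsCyclicSubsequence (s η : ℕ → X) : Prop :=
  ∃ ν : ℕ → ℕ → LInfty μ, (∀ k, IsPartitionOfUnity (ν k)) ∧
    (∀ k m n, ν k m * ν (k + 1) n ≠ 0 → m < n) ∧
    ∀ k n, ν k n • η k = ν k n • s n

variable [LInftyInner μ X]

/-- Cyclically compact sets. -/
def IsCyclicallyCompactSet (C : Set X) : Prop :=
  IsCyclic μ C ∧ ∀ s : ℕ → X, (∀ n, s n ∈ C) →
    ∃ η : ℕ → X, IsCyclicSubsequence μ s η ∧ ∃ ξ ∈ C, NormConverges μ η ξ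

/-- Cyclically compact operators: images of bounded sets are contained in cyclically compact
sets. -/
def IsCyclicallyCompact (T : X →ₗ[LInfty μ] X) : Prop :=
  ∀ C : Set X, (∃ M : ℝ, ∀ ξ ∈ C, normInf μ ξ ≤ M) →
    ∃ K : Set X, IsCyclicallyCompactSet μ K ∧ T '' C ⊆ K

/-- Self-adjoint operators. -/
def IsSelfAdjointOp (T : X →ₗ[LInfty μ] X) : Prop :=
  ∀ ξ η : X, inner μ (T ξ) η = inner μ ξ (T η)

/-- The operator `ξ ⊗ η : ζ ↦ ⟨ζ, η⟩ ξ`. -/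
def tensor (ξ η : X) : X →ₗ[LInfty μ] X where
  toFun ζ := inner μ ζ η • ξ
  map_add' ζ ζ' := by rw [inner, LInftyInner.ip_add_left, add_smul]; rfl
  map_smul' a ζ := by rw [inner, LInftyInner.ip_smul_left, mul_smul]; rfl

/-- `S` is the order sum of the series `∑ u_n` of operators: for some `e_N ↓ 0` in `L^∞(Ω)`, the
difference between `S` and the `N`-th partial sum has vector norm at most `e_N`. -/
def HasOrderSum (t : ℕ → X →ₗ[LInfty μ] X) (S : X →ₗ[LInfty μ] X) : Prop :=
  ∃ e : ℕ → LInfty μ, DecreasesToZero e ∧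
    ∀ N ζ, vnorm μ (S ζ - (∑ n ∈ Finset.range N, t n) ζ) ≤ e N * vnorm μ ζ

end Operators

end CyclicSpectral

end

namespace CyclicSpectral

/-! ### Almost-everywhere calculus in `L^∞(Ω)`: order, constants, Borel functions, idempotents,
supports. -/

namespace LInfty

variable {Ω : Type u} [MeasurableSpace Ω] {μ : Measure Ω}

/-! The classical proof for compact self-adjoint operators is carried out with elements of `L^∞(Ω)`
as scalars: maximize `‖Sξ‖²` over the unit ball, find an eigenvector, subtract its rank one part,
repeat. Squares `nsq ξ = ⟨ξ, ξ⟩` replace norms throughout. A pointwise choice over Ω becomes a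
choice below each nonzero idempotent, extended to a partition of unity by Zorn's lemma and glued by
mixing (`exists_mix_of_local`).

Maximum. If near-maximizers were missing below some idempotent, there would be unit-ball vectors
with arbitrarily large images, against cyclic compactness. Hence `1/(n+1)`-maximizers exist
globally, and the values of `nsq ∘ S` at them converge in norm to the squared norm `h` of `S`
(`exists_maximum`).

Eigenvector. Since `nsq (S²x - h x) ≤ h (h nsq x - nsq (S x))`, near-maximizers almost solve `S²x =
h x`, and cyclic compactness gives an exact solution `ψ`. Factoring `S² - h = (S - √h)(S + √h)` and
choosing a sign on each part of Ω gives `S φ = l φ` with `l² = h` and `nsq φ = supp h`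
(`exists_eigenvector`).

Deflation. Iterating produces `φ n`, `l n` and decreasing `h n = (l n)²`. The `φ n` are orthogonal,
so where all `h n ≥ ε` the vectors `T φ n` stay apart, which cyclic compactness forbids; hence `h n`
decreases to `0` almost everywhere (`ae_exists_lt`).

Decomposition. The supports of the `h n` decrease. For finite `k`, `π k` is the region where exactly
`k` eigenvectors are nonzero, and `π ⊤` the region where all are. On `π k` the operator left after
`k` steps vanishes; on `π ⊤` the remainder after `N` steps is bounded by `|l N|`. -/

theorem ae_norm_le (a : LInfty μ) : ∀ᵐ ω ∂μ, ‖a ω‖ ≤ ‖a‖ := by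
  have h2 := (Lp.memLp a).eLpNorm_lt_top.ne
  filter_upwards [ae_le_eLpNormEssSup (f := ⇑a) (μ := μ)] with ω hω
  rw [Lp.norm_def, eLpNorm_exponent_top] at *
  rw [← toReal_enorm]
  exact ENNReal.toReal_mono h2 hω

theorem norm_le_of_ae {a : LInfty μ} {C : ℝ} (hC : 0 ≤ C) (h : ∀ᵐ ω ∂μ, ‖a ω‖ ≤ C) :
    ‖a‖ ≤ C := by
  rw [Lp.norm_def, eLpNorm_exponent_top]
  exact ENNReal.toReal_le_of_le_ofReal hC (eLpNormEssSup_le_of_ae_bound h)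

theorem le_iff {a b : LInfty μ} : a ≤ b ↔ ∀ᵐ ω ∂μ, a ω ≤ b ω :=
  (Lp.coeFn_le a b).symm

theorem nonneg_iff {a : LInfty μ} : 0 ≤ a ↔ ∀ᵐ ω ∂μ, 0 ≤ a ω := by
  rw [le_iff]
  refine ⟨fun h => ?_, fun h => ?_⟩ <;>
    filter_upwards [h, Lp.coeFn_zero ℂ ∞ μ] with ω h1 h2 <;> simp_all

theorem eq_iff {a b : LInfty μ} : a = b ↔ ∀ᵐ ω ∂μ, a ω = b ω :=
  Lp.ext_iff

theorem eq_zero_iff {a : LInfty μ} : a = 0 ↔ ∀ᵐ ω ∂μ, a ω = 0 :=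
  Lp.eq_zero_iff_ae_eq_zero

theorem ae_add (a b : LInfty μ) : ∀ᵐ ω ∂μ, (a + b) ω = a ω + b ω := Lp.coeFn_add a b

theorem ae_sub (a b : LInfty μ) : ∀ᵐ ω ∂μ, (a - b) ω = a ω - b ω := Lp.coeFn_sub a b

theorem ae_mul (a b : LInfty μ) : ∀ᵐ ω ∂μ, (a * b) ω = a ω * b ω := coeFn_mul a b

theorem ae_one : ∀ᵐ ω ∂μ, (1 : LInfty μ) ω = 1 := coeFn_one

theorem ae_star (a : LInfty μ) : ∀ᵐ ω ∂μ, (star a) ω = star (a ω) := Lp.coeFn_star a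

theorem ae_abs (a : LInfty μ) : ∀ᵐ ω ∂μ, abs a ω = (‖a ω‖ : ℂ) :=
  (memLp_comp _ a).coeFn_toLp

theorem ae_sqrt (a : LInfty μ) : ∀ᵐ ω ∂μ, sqrt a ω = (Real.sqrt (a ω).re : ℂ) :=
  (memLp_comp _ a).coeFn_toLp

instance : IsOrderedRing (LInfty μ) where
  add_le_add_left a b h c := by
    rw [le_iff] at *
    filter_upwards [h, ae_add a c, ae_add b c] with ω h1 h2 h3
    rw [h2, h3]
    gcongr
  zero_le_one := by
    rw [nonneg_iff]
    filter_upwards [ae_one (μ := μ)] with ω h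
    rw [h]
    exact zero_le_one
  mul_le_mul_of_nonneg_left a ha b c h := by
    rw [nonneg_iff] at ha
    rw [le_iff] at *
    filter_upwards [ha, h, ae_mul a b, ae_mul a c] with ω h0 h1 h2 h3
    rw [h2, h3]
    exact mul_le_mul_of_nonneg_left h1 h0
  mul_le_mul_of_nonneg_right a ha b c h := by
    rw [nonneg_iff] at ha
    rw [le_iff] at *
    filter_upwards [ha, h, ae_mul b a, ae_mul c a] with ω h0 h1 h2 h3
    rw [h2, h3]
    exact mul_le_mul_of_nonneg_right h1 h0

theorem star_mul_eq (a b : LInfty μ) : star (a * b) = star a * star b := by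
  rw [eq_iff]
  filter_upwards [ae_star (a * b), ae_mul a b, ae_mul (star a) (star b), ae_star a, ae_star b]
    with ω h1 h2 h3 h4 h5
  rw [h1, h2, h3, h4, h5, _root_.star_mul']

theorem star_add_eq (a b : LInfty μ) : star (a + b) = star a + star b := by
  rw [eq_iff]
  filter_upwards [ae_star (a + b), ae_add a b, ae_add (star a) (star b), ae_star a, ae_star b]
    with ω h1 h2 h3 h4 h5
  rw [h1, h2, h3, h4, h5, star_add]

theorem star_zero_eq : star (0 : LInfty μ) = 0 := by
  simpa using star_add_eq (0 : LInfty μ) 0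

theorem star_neg_eq (a : LInfty μ) : star (-a) = -star a := by
  rw [eq_neg_iff_add_eq_zero, ← star_add_eq, neg_add_cancel, star_zero_eq]

/-- The class of the constant function with value the real number `c`. -/
noncomputable def const (c : ℝ) : LInfty μ := (memLp_top_const (c : ℂ)).toLp _

theorem ae_const (c : ℝ) : ∀ᵐ ω ∂μ, (const c : LInfty μ) ω = (c : ℂ) :=
  (memLp_top_const (c : ℂ)).coeFn_toLp

theorem const_one : (const 1 : LInfty μ) = 1 := by
  rw [eq_iff]
  filter_upwards [ae_const (μ := μ) 1, ae_one (μ := μ)] with ω h1 h2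
  rw [h1, h2]
  simp

theorem const_zero : (const 0 : LInfty μ) = 0 := by
  rw [eq_zero_iff]
  filter_upwards [ae_const (μ := μ) 0] with ω h1
  rw [h1]
  simp

theorem const_add (a b : ℝ) : (const (a + b) : LInfty μ) = const a + const b := by
  rw [eq_iff]
  filter_upwards [ae_const (μ := μ) (a + b), ae_const (μ := μ) a, ae_const (μ := μ) b,
    ae_add (const a : LInfty μ) (const b)] with ω h1 h2 h3 h4
  rw [h1, h4, h2, h3]
  simp

theorem const_mul (a b : ℝ) : (const (a * b) : LInfty μ) = const a * const b := by
  rw [eq_iff]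
  filter_upwards [ae_const (μ := μ) (a * b), ae_const (μ := μ) a, ae_const (μ := μ) b,
    ae_mul (const a : LInfty μ) (const b)] with ω h1 h2 h3 h4
  rw [h1, h4, h2, h3]
  simp

theorem const_two : (const 2 : LInfty μ) = 2 := by
  rw [← one_add_one_eq_two, const_add, const_one, one_add_one_eq_two]

theorem const_mono {a b : ℝ} (h : a ≤ b) : (const a : LInfty μ) ≤ const b := by
  rw [le_iff]
  filter_upwards [ae_const (μ := μ) a, ae_const (μ := μ) b] with ω h1 h2
  rw [h1, h2]
  exact_mod_cast h

theorem const_nonneg {a : ℝ} (h : 0 ≤ a) : (0 : LInfty μ) ≤ const a :=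
  const_zero (μ := μ) ▸ const_mono h

theorem le_const_of_norm_le {a : LInfty μ} {c : ℝ} (ha : 0 ≤ a) (h : ‖a‖ ≤ c) : a ≤ const c := by
  rw [nonneg_iff] at ha
  rw [le_iff]
  filter_upwards [ha, ae_norm_le a, ae_const (μ := μ) c] with ω h1 h2 h3
  rw [h3, Complex.eq_coe_norm_of_nonneg h1]
  exact_mod_cast h2.trans h

theorem norm_le_of_le_const {a : LInfty μ} {c : ℝ} (ha : 0 ≤ a) (hc : 0 ≤ c) (h : a ≤ const c) :
    ‖a‖ ≤ c := by
  rw [nonneg_iff] at ha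
  rw [le_iff] at h
  refine norm_le_of_ae hc ?_
  filter_upwards [ha, h, ae_const (μ := μ) c] with ω h1 h2 h3
  rw [h3, Complex.eq_coe_norm_of_nonneg h1] at h2
  exact_mod_cast h2

theorem le_of_forall_le_add_const {a b : LInfty μ} (h : ∀ ε : ℝ, 0 < ε → a ≤ b + const ε) :
    a ≤ b := by
  have h' : ∀ n : ℕ, ∀ᵐ ω ∂μ, a ω ≤ b ω + ((1 / ((n : ℝ) + 1) : ℝ) : ℂ) := fun n => by
    have := h (1 / ((n : ℝ) + 1)) (by positivity)
    rw [le_iff] at this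
    filter_upwards [this, ae_add b (const (1 / ((n : ℝ) + 1))),
      ae_const (μ := μ) (1 / ((n : ℝ) + 1))] with ω h1 h2 h3
    rwa [h2, h3] at h1
  rw [le_iff]
  filter_upwards [ae_all_iff.2 h'] with ω hω
  simp only [Complex.le_def, Complex.add_re, Complex.ofReal_re, Complex.add_im,
    Complex.ofReal_im, add_zero] at *
  refine ⟨?_, (hω 0).2⟩
  refine le_of_forall_pos_lt_add fun ε hε => ?_
  obtain ⟨n, hn⟩ := exists_nat_one_div_lt hε
  linarith [(hω n).1]

/-- The class `g ∘ a` for a bounded Borel function `g`. -/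
noncomputable def mcomp (g : ℂ → ℂ) (a : LInfty μ) : LInfty μ := by
  classical exact if h : MemLp (fun ω => g (a ω)) ∞ μ then h.toLp _ else 0

theorem ae_mcomp {g : ℂ → ℂ} (hg : Measurable g) {C : ℝ} (hC : ∀ z, ‖g z‖ ≤ C) (a : LInfty μ) :
    ∀ᵐ ω ∂μ, mcomp g a ω = g (a ω) := by
  have h : MemLp (fun ω => g (a ω)) ∞ μ :=
    memLp_top_of_bound (hg.comp (Lp.stronglyMeasurable a).measurable).aestronglyMeasurable C
      (Filter.Eventually.of_forall fun ω => hC _)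
  rw [mcomp, dif_pos h]
  exact h.coeFn_toLp

/-- The idempotent given by the class of the indicator function of a measurable set. -/
noncomputable def indic (A : Set Ω) : LInfty μ := by
  classical exact if h : MemLp (A.indicator fun _ => (1 : ℂ)) ∞ μ then h.toLp _ else 0

theorem ae_indic {A : Set Ω} (hA : MeasurableSet A) :
    ∀ᵐ ω ∂μ, (ω ∈ A → (indic A : LInfty μ) ω = 1) ∧ (ω ∉ A → (indic A : LInfty μ) ω = 0) := by
  have h : MemLp (A.indicator fun _ => (1 : ℂ)) ∞ μ :=
    memLp_top_of_bound (measurable_const.indicator hA).aestronglyMeasurable 1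
      (Filter.Eventually.of_forall fun ω => by
        by_cases h : ω ∈ A <;> simp [h])
  have h2 := h.coeFn_toLp
  rw [indic, dif_pos h]
  filter_upwards [h2] with ω hω
  rw [hω]
  exact ⟨fun h => by simp [h], fun h => by simp [h]⟩

/-- The idempotent `{a ∈ s}`. -/
noncomputable def ind (s : Set ℂ) (a : LInfty μ) : LInfty μ := indic (a ⁻¹' s)

theorem ae_ind {s : Set ℂ} (hs : MeasurableSet s) (a : LInfty μ) :
    ∀ᵐ ω ∂μ, (a ω ∈ s → ind s a ω = 1) ∧ (a ω ∉ s → ind s a ω = 0) :=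
  ae_indic ((Lp.stronglyMeasurable a).measurable hs)

theorem isIdempotentElem_iff_ae {p : LInfty μ} :
    IsIdempotentElem p ↔ ∀ᵐ ω ∂μ, p ω = 0 ∨ p ω = 1 := by
  rw [IsIdempotentElem, eq_iff]
  refine ⟨fun h => ?_, fun h => ?_⟩
  · filter_upwards [h, ae_mul p p] with ω h1 h2
    rw [h2] at h1
    exact IsIdempotentElem.iff_eq_zero_or_one.1 h1
  · filter_upwards [h, ae_mul p p] with ω h1 h2
    rw [h2]
    exact IsIdempotentElem.iff_eq_zero_or_one.2 h1

theorem isIdempotentElem_indic {A : Set Ω} (hA : MeasurableSet A) :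
    IsIdempotentElem (indic A : LInfty μ) := by
  rw [isIdempotentElem_iff_ae]
  filter_upwards [ae_indic (μ := μ) hA] with ω h
  by_cases hω : ω ∈ A
  · exact Or.inr (h.1 hω)
  · exact Or.inl (h.2 hω)

theorem isIdempotentElem_ind {s : Set ℂ} (hs : MeasurableSet s) (a : LInfty μ) :
    IsIdempotentElem (ind s a) :=
  isIdempotentElem_indic ((Lp.stronglyMeasurable a).measurable hs)

theorem star_of_isIdempotentElem {p : LInfty μ} (hp : IsIdempotentElem p) : star p = p := by
  rw [isIdempotentElem_iff_ae] at hp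
  rw [eq_iff]
  filter_upwards [hp, ae_star p] with ω h1 h2
  rcases h1 with h | h <;> simp [h2, h]

theorem nonneg_of_isIdempotentElem {p : LInfty μ} (hp : IsIdempotentElem p) : 0 ≤ p := by
  rw [isIdempotentElem_iff_ae] at hp
  rw [nonneg_iff]
  filter_upwards [hp] with ω h1
  rcases h1 with h | h <;> simp [h]

theorem le_one_of_isIdempotentElem {p : LInfty μ} (hp : IsIdempotentElem p) : p ≤ 1 := by
  have := nonneg_of_isIdempotentElem hp.one_sub
  exact sub_nonneg.1 this

/-- The support idempotent of `a`. -/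
noncomputable def supp (a : LInfty μ) : LInfty μ := ind {0}ᶜ a

theorem ae_supp (a : LInfty μ) : ∀ᵐ ω ∂μ, (a ω ≠ 0 → supp a ω = 1) ∧ (a ω = 0 → supp a ω = 0) := by
  filter_upwards [ae_ind (s := {0}ᶜ) (measurableSet_singleton 0).compl a] with ω h
  exact ⟨h.1, fun h0 => h.2 (by simpa using h0)⟩

theorem isIdempotentElem_supp (a : LInfty μ) : IsIdempotentElem (supp a) :=
  isIdempotentElem_ind (measurableSet_singleton 0).compl a

theorem supp_mul_self (a : LInfty μ) : supp a * a = a := by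
  rw [eq_iff]
  filter_upwards [ae_supp a, ae_mul (supp a) a] with ω h1 h2
  rw [h2]
  by_cases h : a ω = 0
  · simp [h]
  · rw [h1.1 h, one_mul]

theorem supp_mul_eq_zero {a b : LInfty μ} (h : a * b = 0) : supp a * b = 0 := by
  rw [eq_zero_iff] at *
  filter_upwards [ae_supp a, ae_mul (supp a) b, ae_mul a b, h] with ω h1 h2 h3 h4
  rw [h3] at h4
  rw [h2]
  by_cases h : a ω = 0
  · simp [h1.2 h]
  · simpa [h] using Or.inr h4

theorem sqrt_nonneg (a : LInfty μ) : 0 ≤ sqrt a := by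
  rw [nonneg_iff]
  filter_upwards [ae_sqrt a] with ω h
  rw [h]
  exact_mod_cast Real.sqrt_nonneg _

theorem sqrt_mul_sqrt {a : LInfty μ} (ha : 0 ≤ a) : sqrt a * sqrt a = a := by
  rw [nonneg_iff] at ha
  rw [eq_iff]
  filter_upwards [ae_sqrt a, ae_mul (sqrt a) (sqrt a), ha] with ω h1 h2 h3
  rw [h2, h1, ← Complex.ofReal_mul, Real.mul_self_sqrt (Complex.nonneg_iff.1 h3).1]
  exact (Complex.eq_re_of_ofReal_le (r := 0) (by simpa using h3)).symm

theorem star_of_nonneg {a : LInfty μ} (ha : 0 ≤ a) : star a = a := by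
  rw [nonneg_iff] at ha
  rw [eq_iff]
  filter_upwards [ae_star a, ha] with ω h1 h2
  rw [h1]
  exact Complex.conj_eq_iff_im.2 (Complex.nonneg_iff.1 h2).2.symm

theorem star_mul_self_nonneg' (a : LInfty μ) : 0 ≤ star a * a := by
  rw [nonneg_iff]
  filter_upwards [ae_star a, ae_mul (star a) a] with ω h1 h2
  rw [h2, h1]
  exact star_mul_self_nonneg _

theorem sqrt_le_mul_sqrt {a b m : LInfty μ} (ha : 0 ≤ a) (hb : 0 ≤ b) (hm : 0 ≤ m)
    (h : a ≤ m * m * b) : sqrt a ≤ m * sqrt b := by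
  simp only [nonneg_iff] at ha hb hm
  rw [le_iff] at *
  filter_upwards [ae_sqrt a, ae_sqrt b, ae_mul m (sqrt b), ae_mul (m * m) b, ae_mul m m,
    ha, hb, hm, h] with ω h1 h2 h3 h4 h5 h6 h7 h8 h9
  rw [h4, h5] at h9
  rw [h3, h1, h2]
  obtain ⟨x, hx, hx'⟩ := RCLike.nonneg_iff_exists_ofReal.1 h6
  obtain ⟨y, hy, hy'⟩ := RCLike.nonneg_iff_exists_ofReal.1 h7
  obtain ⟨z, hz, hz'⟩ := RCLike.nonneg_iff_exists_ofReal.1 h8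
  simp only [← hx', ← hy', ← hz', Complex.coe_algebraMap, Complex.ofReal_re] at h9 ⊢
  norm_cast at h9 ⊢
  refine Real.sqrt_le_iff.2 ⟨by positivity, ?_⟩
  rw [mul_pow, Real.sq_sqrt hy]
  linarith

/-! ### Partitions of unity: localization and exhaustion. -/

/-- The index set may be uncountable, so null sets cannot be united. Instead the idempotent `{a ∈
s}` dominates every `π i` and must equal `1`, because the supremum is taken in `∇`. -/
theorem IsPartitionOfUnity.ae_mem {I : Type*} {π : I → LInfty μ} (hπ : IsPartitionOfUnity π)
    {s : Set ℂ} (hs : MeasurableSet s) {a : LInfty μ}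
    (h : ∀ i, ∀ᵐ ω ∂μ, π i ω = 1 → a ω ∈ s) : ∀ᵐ ω ∂μ, a ω ∈ s := by
  have h1 := hπ.2.2 (ind s a) (isIdempotentElem_ind hs a) fun i => by
    rw [eq_iff]
    filter_upwards [h i, isIdempotentElem_iff_ae.1 (hπ.1 i), ae_ind hs a, ae_mul (π i) (ind s a)]
      with ω h1 h2 h3 h4
    rw [h4]
    rcases h2 with h | h
    · simp [h]
    · rw [h3.1 (h1 h), mul_one]
  rw [eq_iff] at h1
  filter_upwards [h1, ae_ind hs a, ae_one (μ := μ)] with ω h2 h3 h4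
  by_contra h
  rw [h3.2 h, h4] at h2
  exact zero_ne_one h2

theorem IsPartitionOfUnity.eq_zero {I : Type*} {π : I → LInfty μ} (hπ : IsPartitionOfUnity π)
    {a : LInfty μ} (h : ∀ i, π i * a = 0) : a = 0 := by
  rw [eq_zero_iff]
  refine hπ.ae_mem (s := {0}) (measurableSet_singleton 0) fun i => ?_
  filter_upwards [eq_zero_iff.1 (h i), ae_mul (π i) a] with ω h1 h2 h3
  simpa [h1, h3] using h2.symm

theorem IsPartitionOfUnity.le {I : Type*} {π : I → LInfty μ} (hπ : IsPartitionOfUnity π)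
    {a b : LInfty μ} (h : ∀ i, π i * a ≤ π i * b) : a ≤ b := by
  have : ∀ᵐ ω ∂μ, (b - a) ω ∈ Set.Ici (0 : ℂ) := by
    refine hπ.ae_mem isClosed_Ici.measurableSet fun i => ?_
    filter_upwards [le_iff.1 (h i), ae_mul (π i) a, ae_mul (π i) b, ae_sub b a] with ω h1 h2 h3 h4 h5
    rw [h2, h3, h5, one_mul, one_mul] at h1
    rw [h4]
    exact sub_nonneg.2 h1
  rw [le_iff]
  filter_upwards [this, ae_sub b a] with ω h1 h2
  rw [h2] at h1
  exact sub_nonneg.1 h1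

theorem IsPartitionOfUnity.ulift {π : ℕ → LInfty μ} (hπ : IsPartitionOfUnity π) :
    IsPartitionOfUnity fun i : ULift.{u} ℕ => π i.down :=
  ⟨fun _ => hπ.1 _, fun _ _ h => hπ.2.1 _ _ fun h' => h (ULift.ext _ _ h'),
    fun ρ hρ h => hπ.2.2 ρ hρ fun i => h ⟨i⟩⟩

/-- Exhaustion: a property of idempotents that holds somewhere below each nonzero idempotent
holds along a partition of unity. -/
theorem exists_isPartitionOfUnity {P : LInfty μ → Prop}
    (h : ∀ q : LInfty μ, IsIdempotentElem q → q ≠ 0 →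
      ∃ p : LInfty μ, IsIdempotentElem p ∧ p ≠ 0 ∧ p * q = p ∧ P p) :
    ∃ (I : Type u) (π : I → LInfty μ), IsPartitionOfUnity π ∧ ∀ i, P (π i) := by
  obtain ⟨A, hA⟩ := zorn_subset {A : Set (LInfty μ) | (∀ p ∈ A, IsIdempotentElem p ∧ P p) ∧
      A.Pairwise fun p q => p * q = 0} fun c hc hchain => by
    refine ⟨⋃₀ c, ⟨?_, ?_⟩, fun s hs => Set.subset_sUnion_of_mem hs⟩
    · rintro p ⟨s, hs, hp⟩
      exact (hc hs).1 p hp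
    · rw [Set.pairwise_sUnion hchain.directedOn]
      exact fun s hs => (hc hs).2
  refine ⟨A, fun p => p.1, ⟨fun p => (hA.1.1 p p.2).1, fun p q hpq =>
    hA.1.2 p.2 q.2 fun h => hpq (Subtype.ext h), fun ρ hρ hle => ?_⟩, fun p => (hA.1.1 p p.2).2⟩
  by_contra hne
  -- An upper bound `ρ ≠ 1` leaves room below `1 - ρ` for one more piece, contradicting maximality
  -- of `A`.
  obtain ⟨p, hp, hp0, hpq, hPp⟩ := h (1 - ρ) hρ.one_sub fun h0 => hne (sub_eq_zero.1 h0).symm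
  have hpρ : p * ρ = 0 := by
    have : p * (1 - ρ) * ρ = 0 := by rw [mul_assoc, sub_mul, hρ.eq]; simp
    rwa [hpq] at this
  have hdisj : ∀ q ∈ A, p * q = 0 := fun q hq => by
    rw [← show q * ρ = q from hle ⟨q, hq⟩, mul_comm q, ← mul_assoc, hpρ, zero_mul]
  have hmem : p ∈ A := by
    refine hA.2 (y := insert p A) ⟨?_, ?_⟩ (Set.subset_insert p A) (Set.mem_insert p A)
    · rintro q (rfl | hq)
      · exact ⟨hp, hPp⟩
      · exact hA.1.1 q hq
    · refine hA.1.2.insert fun q hq _ => ⟨hdisj q hq, ?_⟩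
      rw [mul_comm]
      exact hdisj q hq
  exact hp0 (hp.eq.symm.trans (hdisj p hmem))

end LInfty

open LInfty

/-! ### Inner product calculus, gluing, and cyclic subsequences of images. -/

section Module

variable {Ω : Type u} [MeasurableSpace Ω] {μ : Measure Ω} {X : Type v} [AddCommGroup X]
  [Module (LInfty μ) X] [LInftyInner μ X]

theorem inner_conj (ξ η : X) : star (inner μ η ξ) = inner μ ξ η :=
  (LInftyInner.ip_conj ξ η).symm

theorem inner_add_left (ξ η ζ : X) : inner μ (ξ + η) ζ = inner μ ξ ζ + inner μ η ζ :=
  LInftyInner.ip_add_left ξ η ζ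

theorem inner_smul_left (a : LInfty μ) (ξ η : X) : inner μ (a • ξ) η = a * inner μ ξ η :=
  LInftyInner.ip_smul_left a ξ η

theorem inner_add_right (ξ η ζ : X) : inner μ ξ (η + ζ) = inner μ ξ η + inner μ ξ ζ := by
  rw [← inner_conj, inner_add_left, star_add_eq, inner_conj, inner_conj]

theorem inner_smul_right (a : LInfty μ) (ξ η : X) :
    inner μ ξ (a • η) = star a * inner μ ξ η := by
  rw [← inner_conj, inner_smul_left, star_mul_eq, inner_conj]

theorem inner_zero_left (η : X) : inner μ (0 : X) η = 0 := by
  simpa using inner_smul_left (0 : LInfty μ) (0 : X) η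

theorem inner_zero_right (η : X) : inner μ η (0 : X) = 0 := by
  rw [← inner_conj, inner_zero_left, star_zero_eq]

theorem inner_neg_left (ξ η : X) : inner μ (-ξ) η = -inner μ ξ η := by
  simpa using inner_smul_left (-1 : LInfty μ) ξ η

theorem inner_neg_right (ξ η : X) : inner μ ξ (-η) = -inner μ ξ η := by
  rw [← inner_conj, inner_neg_left, star_neg_eq, inner_conj]

theorem inner_sub_left (ξ η ζ : X) : inner μ (ξ - η) ζ = inner μ ξ ζ - inner μ η ζ := by
  rw [sub_eq_add_neg, inner_add_left, inner_neg_left, sub_eq_add_neg]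

theorem inner_sub_right (ξ η ζ : X) : inner μ ξ (η - ζ) = inner μ ξ η - inner μ ξ ζ := by
  rw [sub_eq_add_neg, inner_add_right, inner_neg_right, sub_eq_add_neg]

variable (μ) in
/-- The square `⟨ξ, ξ⟩` of the vector norm. -/
noncomputable def nsq (ξ : X) : LInfty μ := inner μ ξ ξ

theorem nsq_nonneg (ξ : X) : 0 ≤ nsq μ ξ := LInftyInner.ip_self_nonneg ξ

theorem nsq_eq_zero {ξ : X} : nsq μ ξ = 0 ↔ ξ = 0 := LInftyInner.ip_self_eq_zero ξ

theorem nsq_zero : nsq μ (0 : X) = 0 := nsq_eq_zero.2 rfl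

theorem nsq_smul (a : LInfty μ) (ξ : X) : nsq μ (a • ξ) = star a * a * nsq μ ξ := by
  rw [nsq, inner_smul_left, inner_smul_right, nsq]
  ring

theorem nsq_smul_of_nonneg {a : LInfty μ} (ha : 0 ≤ a) (ξ : X) :
    nsq μ (a • ξ) = a * a * nsq μ ξ := by
  rw [nsq_smul, star_of_nonneg ha]

theorem nsq_smul_of_isIdempotentElem {p : LInfty μ} (hp : IsIdempotentElem p) (ξ : X) :
    nsq μ (p • ξ) = p * nsq μ ξ := by
  rw [nsq_smul, star_of_isIdempotentElem hp, hp.eq]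

/-- By the parallelogram law the two sides differ by `nsq (ξ - η)`. This inequality stands in for
the triangle inequality and avoids square roots. -/
theorem nsq_add_le (ξ η : X) : nsq μ (ξ + η) ≤ 2 * nsq μ ξ + 2 * nsq μ η := by
  have h := nsq_nonneg (μ := μ) (ξ - η)
  rw [← sub_nonneg]
  convert h using 1
  simp only [nsq, inner_add_left, inner_add_right, inner_sub_left, inner_sub_right]
  ring

theorem nsq_sub_le (ξ η : X) : nsq μ (ξ - η) ≤ 2 * nsq μ ξ + 2 * nsq μ η := by
  have h := nsq_nonneg (μ := μ) (ξ + η)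
  rw [← sub_nonneg]
  convert h using 1
  simp only [nsq, inner_add_left, inner_add_right, inner_sub_left, inner_sub_right]
  ring

theorem mul_inner_congr {p : LInfty μ} (hp : IsIdempotentElem p) {ξ ξ' η η' : X}
    (h : p • ξ = p • ξ') (h' : p • η = p • η') : p * inner μ ξ η = p * inner μ ξ' η' := by
  have key : ∀ α β : X, p * inner μ α β = inner μ (p • α) (p • β) := fun α β => by
    rw [inner_smul_left, inner_smul_right, star_of_isIdempotentElem hp, ← mul_assoc, hp.eq]
  rw [key, h, h', ← key]

theorem mul_nsq_congr {p : LInfty μ} (hp : IsIdempotentElem p) {ξ ξ' : X}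
    (h : p • ξ = p • ξ') : p * nsq μ ξ = p * nsq μ ξ' := mul_inner_congr hp h h

theorem smul_eq_self_of_nsq_eq {p : LInfty μ} (hp : IsIdempotentElem p) {ξ : X}
    (h : p * nsq μ ξ = nsq μ ξ) : p • ξ = ξ := by
  have : nsq μ ((1 - p) • ξ) = 0 := by
    rw [nsq_smul_of_isIdempotentElem hp.one_sub, sub_mul, one_mul, h, sub_self]
  rw [nsq_eq_zero, sub_smul, one_smul, sub_eq_zero] at this
  exact this.symm

theorem normInf_le_one {ξ : X} (h : nsq μ ξ ≤ 1) : normInf μ ξ ≤ 1 := by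
  rw [normInf, Real.sqrt_le_one]
  exact norm_le_of_le_const (nsq_nonneg ξ) zero_le_one (const_one (μ := μ) ▸ h)

theorem NormConverges.nsq_le {s : ℕ → X} {ξ : X} (h : NormConverges μ s ξ) {ε : ℝ} (hε : 0 < ε) :
    ∃ N, ∀ n ≥ N, nsq μ (s n - ξ) ≤ const ε := by
  obtain ⟨N, hN⟩ := h _ (Real.sqrt_pos.2 hε)
  refine ⟨N, fun n hn => le_const_of_norm_le (nsq_nonneg _) ?_⟩
  exact ((Real.sqrt_lt_sqrt_iff (norm_nonneg _)).1 (hN n hn)).le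

variable [HilbertKaplanskyModule μ X]

theorem LInfty.IsPartitionOfUnity.ext {I : Type u} {π : I → LInfty μ} (hπ : IsPartitionOfUnity π)
    {ξ η : X} (h : ∀ i, π i • ξ = π i • η) : ξ = η := by
  refine sub_eq_zero.1 (HilbertKaplanskyModule.eq_zero_of_partition (μ := μ) I π _ hπ fun i => ?_)
  rw [smul_sub, h, sub_self]

theorem LInfty.IsPartitionOfUnity.exists_mix {I : Type u} {π : I → LInfty μ}
    (hπ : IsPartitionOfUnity π) {s : I → X} (hs : ∀ i, nsq μ (s i) ≤ 1) :
    ∃ ξ : X, nsq μ ξ ≤ 1 ∧ ∀ i, π i • ξ = π i • s i := by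
  obtain ⟨ξ, hξ⟩ := HilbertKaplanskyModule.exists_mixing I π s hπ
    ⟨1, fun i => normInf_le_one (hs i)⟩
  refine ⟨ξ, hπ.le fun i => ?_, hξ⟩
  rw [mul_nsq_congr (hπ.1 i) (hξ i)]
  exact mul_le_mul_of_nonneg_left (hs i) (nonneg_of_isIdempotentElem (hπ.1 i))

/-- A property of pairs (idempotent, vector of the unit ball) that can be achieved somewhere below
each nonzero idempotent is achieved along a partition of unity by a single vector. -/
theorem exists_mix_of_local {P : LInfty μ → X → Prop}
    (h : ∀ q : LInfty μ, IsIdempotentElem q → q ≠ 0 →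
      ∃ p : LInfty μ, IsIdempotentElem p ∧ p ≠ 0 ∧ p * q = p ∧ ∃ ξ, nsq μ ξ ≤ 1 ∧ P p ξ) :
    ∃ (I : Type u) (π : I → LInfty μ) (s : I → X) (ξ : X), IsPartitionOfUnity π ∧ nsq μ ξ ≤ 1 ∧
      ∀ i, P (π i) (s i) ∧ π i • ξ = π i • s i := by
  obtain ⟨I, π, hπ, hs⟩ := exists_isPartitionOfUnity h
  choose s hs1 hs2 using hs
  obtain ⟨ξ, hξ, hξ'⟩ := hπ.exists_mix hs1
  exact ⟨I, π, s, ξ, hπ, hξ, fun i => ⟨hs2 i, hξ' i⟩⟩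

/-- A cyclically compact operator sends suitable mixings of a sequence of the unit ball to a
convergent sequence. -/
theorem IsCyclicallyCompact.exists_convergent {S : X →ₗ[LInfty μ] X} (hS : IsCyclicallyCompact μ S)
    {s : ℕ → X} (hs : ∀ n, nsq μ (s n) ≤ 1) :
    ∃ (ν : ℕ → ℕ → LInfty μ) (ζ : ℕ → X) (χ : X), (∀ k, IsPartitionOfUnity (ν k)) ∧
      (∀ k m n, ν k m * ν (k + 1) n ≠ 0 → m < n) ∧ (∀ k n, ν k n ≠ 0 → k ≤ n) ∧
      (∀ k n, ν k n • ζ k = ν k n • s n) ∧ (∀ k, nsq μ (ζ k) ≤ 1) ∧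
      NormConverges μ (fun k => S (ζ k)) χ := by
  obtain ⟨K, hK, hSK⟩ := hS {ξ | nsq μ ξ ≤ 1} ⟨1, fun ξ hξ => normInf_le_one hξ⟩
  obtain ⟨η, ⟨ν, hν, hlt, hη⟩, χ, -, hχ⟩ := hK.2 (fun n => S (s n)) fun n =>
    hSK (Set.mem_image_of_mem _ (hs n))
  -- The mixing is done on the vectors `s n` before applying `S`. Since `S` commutes with
  -- idempotents, the resulting `S (ζ k)` is the given cyclic subsequence of images.
  have hex : ∀ k, ∃ ξ : X, nsq μ ξ ≤ 1 ∧ ∀ i : ULift.{u} ℕ, ν k i.down • ξ = ν k i.down • s i.down :=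
    fun k => (hν k).ulift.exists_mix fun i => hs _
  choose ζ hζ1 hζ using hex
  have hηζ : η = fun k => S (ζ k) := by
    funext k
    refine (hν k).ulift.ext fun i => ?_
    rw [hη, ← map_smul, ← map_smul, hζ]
  refine ⟨ν, ζ, χ, hν, hlt, fun k => ?_, fun k n => hζ k ⟨n⟩, hζ1, hηζ ▸ hχ⟩
  -- The indices active in `ν k` strictly increase with `k` on every common part, so they are at
  -- least `k`.
  induction k with
  | zero => exact fun n _ => Nat.zero_le n
  | succ k ih =>
    intro n hn
    by_contra hkn
    refine hn ((hν k).eq_zero fun m => ?_)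
    by_contra hm
    have := ih m fun h0 => hm (by rw [h0, zero_mul])
    exact hkn (this.trans_lt (hlt k m n hm))

end Module

/-! ### Existence of the maximum of `nsq (S ξ)` over the unit ball. -/

namespace LInfty

variable {Ω : Type u} [MeasurableSpace Ω] {μ : Measure Ω}

theorem le_of_forall_le_add_mul_const {a b c : LInfty μ} (hc : 0 ≤ c)
    (h : ∀ ε : ℝ, 0 < ε → a ≤ b + c * const ε) : a ≤ b := by
  refine le_of_forall_le_add_const fun ε hε => ?_
  have hpos : 0 < ‖c‖ + 1 := by positivity
  refine (h (ε / (‖c‖ + 1)) (by positivity)).trans (add_le_add_right ?_ b)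
  have h1 : c ≤ const (‖c‖ + 1) := le_const_of_norm_le hc (by linarith)
  refine (mul_le_mul_of_nonneg_right h1 (const_nonneg (by positivity))).trans ?_
  rw [← const_mul, mul_div_cancel₀ _ hpos.ne']

theorem norm_sub_le_of_le {a b : LInfty μ} {c : ℝ} (hc : 0 ≤ c) (h1 : a ≤ b + const c)
    (h2 : b ≤ a + const c) : ‖a - b‖ ≤ c := by
  rw [le_iff] at h1 h2
  refine norm_le_of_ae hc ?_
  filter_upwards [h1, h2, ae_add a (const c), ae_add b (const c), ae_const (μ := μ) c, ae_sub a b]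
    with ω h3 h4 h5 h6 h7 h8
  rw [h6, h7] at h3
  rw [h5, h7] at h4
  rw [h8]
  simp only [Complex.le_def, Complex.add_re, Complex.ofReal_re, Complex.add_im,
    Complex.ofReal_im, add_zero] at h3 h4
  rw [← Complex.abs_re_eq_norm.2 (by simp [h3.2]), Complex.sub_re, abs_le]
  constructor <;> linarith

theorem ae_tendsto {f : ℕ → LInfty μ} {a : LInfty μ}
    (h : Filter.Tendsto f Filter.atTop (nhds a)) :
    ∀ᵐ ω ∂μ, Filter.Tendsto (fun n => f n ω) Filter.atTop (nhds (a ω)) := by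
  have h1 : ∀ᵐ ω ∂μ, ∀ n, ‖(f n - a) ω‖ ≤ ‖f n - a‖ := ae_all_iff.2 fun n => ae_norm_le _
  have h2 : ∀ᵐ ω ∂μ, ∀ n, (f n - a) ω = f n ω - a ω := ae_all_iff.2 fun n => ae_sub _ _
  filter_upwards [h1, h2] with ω h3 h4
  rw [tendsto_iff_norm_sub_tendsto_zero] at h ⊢
  exact squeeze_zero (fun n => norm_nonneg _) (fun n => h4 n ▸ h3 n) h

theorem le_of_mul_le {p a b : LInfty μ} (h : p * a ≤ p * b) :
    ∀ᵐ ω ∂μ, p ω = 1 → a ω ≤ b ω := by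
  rw [le_iff] at h
  filter_upwards [h, ae_mul p a, ae_mul p b] with ω h1 h2 h3 h4
  rwa [h2, h3, h4, one_mul, one_mul] at h1

end LInfty

section Module

variable {Ω : Type u} [MeasurableSpace Ω] {μ : Measure Ω} {X : Type v} [AddCommGroup X]
  [Module (LInfty μ) X] [LInftyInner μ X]

theorem mul_nsq_map_congr (S : X →ₗ[LInfty μ] X) {p : LInfty μ} (hp : IsIdempotentElem p)
    {ξ η : X} (h : p • ξ = p • η) : p * nsq μ (S ξ) = p * nsq μ (S η) :=
  mul_nsq_congr hp (by rw [← map_smul, h, map_smul])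

/-- If `x ≥ r` on `p` and `y ≤ x + ε` fails on `p`, then `y ≥ r + ε` on a nonzero idempotent
below `p`. -/
theorem exists_idempotent_of_not_le {p x y : LInfty μ} (hp : IsIdempotentElem p) (hx : 0 ≤ x)
    (hy : 0 ≤ y) {r ε : ℝ} (hr : p * const r ≤ p * x) (h : ¬ p * y ≤ p * (x + const ε)) :
    ∃ p' : LInfty μ, IsIdempotentElem p' ∧ p' ≠ 0 ∧ p' * p = p' ∧
      p' * const (r + ε) ≤ p' * y := by
  have hs : MeasurableSet (Set.Ici (0 : ℂ))ᶜ := isClosed_Ici.measurableSet.compl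
  set a := p * (x + const ε) - p * y with ha
  set e := ind (Set.Ici (0 : ℂ))ᶜ a with he
  refine ⟨p * e, hp.mul (isIdempotentElem_ind hs a), fun h0 => h ?_, ?_, ?_⟩
  · rw [← sub_nonneg, nonneg_iff]
    filter_upwards [eq_zero_iff.1 h0, ae_mul p e, ae_ind hs a, ae_mul p (x + const ε), ae_mul p y,
      ae_sub (p * (x + const ε)) (p * y)] with ω h1 h2 h3 h4 h5 h6
    by_contra hneg
    have h7 : e ω = 1 := h3.1 hneg
    rw [h2, h7, mul_one] at h1
    refine hneg ?_
    rw [h6, h4, h5, h1]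
    simp
  · rw [mul_right_comm, hp.eq]
  · rw [nonneg_iff] at hx hy
    rw [le_iff]
    filter_upwards [le_of_mul_le hr, ae_mul p e, ae_ind hs a, ae_mul p (x + const ε), ae_mul p y,
      ae_sub (p * (x + const ε)) (p * y), isIdempotentElem_iff_ae.1 hp, hx, hy,
      ae_add x (const ε), ae_const (μ := μ) r, ae_const (μ := μ) ε, ae_const (μ := μ) (r + ε),
      ae_mul (p * e) y, ae_mul (p * e) (const (r + ε))]
      with ω h1 h2 h3 h4 h5 h6 h7 h8 h9 h10 h11 h12 h13 h14 h15
    rw [h14, h15, h2, h13]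
    rcases h7 with h7 | h7
    · simp [h7]
    by_cases hneg : a ω ∈ (Set.Ici (0 : ℂ))ᶜ
    · rw [show e ω = 1 from h3.1 hneg, h7]
      have h16 : ¬ 0 ≤ a ω := hneg
      rw [h6, h4, h5, h7, h10, h12, one_mul, one_mul] at h16
      have h17 := h1 h7
      rw [h11] at h17
      simp only [Complex.le_def, Complex.zero_re, Complex.zero_im, Complex.sub_re, Complex.sub_im,
        Complex.add_re, Complex.ofReal_re, Complex.add_im, Complex.ofReal_im, mul_one, one_mul,
        not_and] at *
      refine ⟨?_, h9.2⟩
      -- The order of `ℂ` is not total; failure of `0 ≤ a ω` bounds the real parts only because `x`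
      -- and `y` are real.
      by_contra hlt
      exact h16 (by linarith) (by rw [← h8.2, ← h9.2]; simp)
    · rw [show e ω = 0 from h3.2 hneg]
      simp

/-- The bound on the unit ball is applied to `η` rescaled by `(nsq η + δ)^(-1/2)`. The shift `δ > 0`
keeps this factor in `L^∞(Ω)` where `nsq η` is small or zero, and is then sent to `0`. -/
theorem nsq_map_le_mul {S : X →ₗ[LInfty μ] X} {h : LInfty μ} (h0 : 0 ≤ h)
    (hS : ∀ η : X, nsq μ η ≤ 1 → nsq μ (S η) ≤ h) (η : X) : nsq μ (S η) ≤ h * nsq μ η := by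
  refine le_of_forall_le_add_mul_const h0 fun δ hδ => ?_
  set g := mcomp (fun z => (((√(‖z‖ + δ))⁻¹ : ℝ) : ℂ)) (nsq μ η) with hg
  have hgae : ∀ᵐ ω ∂μ, g ω = (((√(‖nsq μ η ω‖ + δ))⁻¹ : ℝ) : ℂ) := by
    refine ae_mcomp (by fun_prop) (C := (√δ)⁻¹) (fun z => ?_) _
    rw [Complex.norm_real, Real.norm_of_nonneg (by positivity)]
    have : 0 < √δ := Real.sqrt_pos.2 hδ
    gcongr
    linarith [norm_nonneg z]
  have hg0 : 0 ≤ g := by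
    rw [nonneg_iff]
    filter_upwards [hgae] with ω h1
    rw [h1]
    exact_mod_cast inv_nonneg.2 (Real.sqrt_nonneg _)
  have hgg : g * g * (nsq μ η + const δ) = 1 := by
    rw [eq_iff]
    filter_upwards [hgae, ae_mul (g * g) (nsq μ η + const δ), ae_mul g g,
      ae_add (nsq μ η) (const δ), ae_const (μ := μ) δ, ae_one (μ := μ),
      nonneg_iff.1 (nsq_nonneg (μ := μ) η)] with ω h1 h2 h3 h4 h5 h6 h7
    rw [h2, h3, h4, h5, h6, h1]
    nth_rw 3 [Complex.eq_coe_norm_of_nonneg h7]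
    norm_cast
    have : 0 < ‖nsq μ η ω‖ + δ := by positivity
    rw [← mul_inv, Real.mul_self_sqrt this.le, inv_mul_cancel₀ this.ne']
  have hδ0 : (0 : LInfty μ) ≤ const δ := const_nonneg hδ.le
  have h1 := hS (g • η) (by
    rw [nsq_smul_of_nonneg hg0, ← hgg]
    refine mul_le_mul_of_nonneg_left ?_ (mul_nonneg hg0 hg0)
    simpa using hδ0)
  rw [map_smul, nsq_smul_of_nonneg hg0] at h1
  have h2 := mul_le_mul_of_nonneg_right h1 (add_nonneg (nsq_nonneg (μ := μ) η) hδ0)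
  rwa [mul_right_comm, hgg, one_mul, mul_add] at h2

variable [HilbertKaplanskyModule μ X]

/-- A cyclically compact operator cannot be uniformly large on a fixed nonzero idempotent. -/
theorem IsCyclicallyCompact.eq_zero_of_unbounded {S : X →ₗ[LInfty μ] X}
    (hS : IsCyclicallyCompact μ S) {q : LInfty μ} (hq : IsIdempotentElem q) {ε : ℝ} (hε : 0 < ε)
    (h : ∀ n : ℕ, ∃ ξ : X, nsq μ ξ ≤ 1 ∧ q * const (n * ε) ≤ q * nsq μ (S ξ)) : q = 0 := by
  have hq0 := nonneg_of_isIdempotentElem hq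
  choose s hs1 hs2 using h
  obtain ⟨ν, ζ, χ, hν, -, hle, hmix, -, hχ⟩ := hS.exists_convergent hs1
  -- Only indices `n ≥ k` enter `ζ k`, so mixing preserves the growth of the lower bounds.
  have hlow : ∀ k : ℕ, q * const (k * ε) ≤ q * nsq μ (S (ζ k)) := fun k => by
    refine (hν k).le fun n => ?_
    have hνn := (hν k).1 n
    by_cases h0 : ν k n = 0
    · simp [h0]
    · rw [mul_left_comm _ q (nsq μ _), mul_nsq_map_congr S hνn (hmix k n),
        mul_left_comm q (ν k n)]
      refine mul_le_mul_of_nonneg_left (le_trans ?_ (hs2 n)) (nonneg_of_isIdempotentElem hνn)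
      refine mul_le_mul_of_nonneg_left (const_mono ?_) hq0
      have : (k : ℝ) ≤ n := by exact_mod_cast hle k n h0
      gcongr
  obtain ⟨N, hN⟩ := hχ.nsq_le one_pos
  obtain ⟨k, hk⟩ := exists_nat_ge ((2 * ‖nsq μ χ‖ + 3) / ε)
  set n := max N k
  have hn : 2 * ‖nsq μ χ‖ + 3 ≤ n * ε := by
    rw [div_le_iff₀ hε] at hk
    have : (k : ℝ) ≤ n := by exact_mod_cast le_max_right N k
    exact hk.trans (by gcongr)
  -- Convergence caps `nsq (S (ζ n))` at `2‖nsq χ‖ + 2`, while `n` was chosen so that the lower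
  -- bound on `q` is one more.
  have hup : nsq μ (S (ζ n)) ≤ const (2 * ‖nsq μ χ‖ + 2) := by
    have h1 := nsq_add_le (μ := μ) χ (S (ζ n) - χ)
    rw [add_sub_cancel] at h1
    have h2 : nsq μ χ ≤ const ‖nsq μ χ‖ := le_const_of_norm_le (nsq_nonneg χ) le_rfl
    have h3 := hN n (le_max_left N k)
    rw [const_one] at h3
    rw [const_add, const_mul, const_two]
    refine h1.trans (add_le_add (mul_le_mul_of_nonneg_left h2 zero_le_two) ?_)
    simpa using mul_le_mul_of_nonneg_left h3 (zero_le_two (α := LInfty μ))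
  have h1 : q * const (2 * ‖nsq μ χ‖ + 3) ≤ q * const (2 * ‖nsq μ χ‖ + 2) :=
    (mul_le_mul_of_nonneg_left (const_mono hn) hq0).trans
      ((hlow n).trans (mul_le_mul_of_nonneg_left hup hq0))
  rw [show 2 * ‖nsq μ χ‖ + 3 = 2 * ‖nsq μ χ‖ + 2 + 1 by ring, const_add _ 1, const_one, mul_add,
    mul_one] at h1
  exact le_antisymm (by simpa using h1) hq0

/-- It suffices to find `ε`-maximizers below each nonzero `q` and glue them. If there were none
below `q`, values could be raised by `ε` again and again on smaller idempotents. -/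
theorem IsCyclicallyCompact.exists_almost_maximal {S : X →ₗ[LInfty μ] X}
    (hS : IsCyclicallyCompact μ S) {ε : ℝ} (hε : 0 < ε) :
    ∃ ξ : X, nsq μ ξ ≤ 1 ∧ ∀ η : X, nsq μ η ≤ 1 → nsq μ (S η) ≤ nsq μ (S ξ) + const ε := by
  obtain ⟨I, π, s, ξ, hπ, hξ, hs⟩ := exists_mix_of_local (μ := μ) (X := X) (P := fun p ξ =>
      ∀ η : X, nsq μ η ≤ 1 → p * nsq μ (S η) ≤ p * (nsq μ (S ξ) + const ε)) fun q hq hq0 => by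
    by_contra! hcon
    have hstep : ∀ (n : ℕ) (r : LInfty μ), IsIdempotentElem r → r ≠ 0 → r * q = r →
        ∃ p : LInfty μ, IsIdempotentElem p ∧ p ≠ 0 ∧ p * r = p ∧
          ∃ ξ : X, nsq μ ξ ≤ 1 ∧ p * const (n * ε) ≤ p * nsq μ (S ξ) := by
      intro n r hr hr0 hrq
      induction n with
      | zero =>
        refine ⟨r, hr, hr0, hr.eq, 0, by rw [nsq_zero]; exact zero_le_one, ?_⟩
        simp [const_zero, nsq_zero]
      | succ n ih =>
        obtain ⟨p, hp, hp0, hpr, ξ, hξ, hpξ⟩ := ih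
        obtain ⟨η, hη, hpη⟩ := hcon p hp hp0 (by rw [← hpr, mul_assoc, hrq]) ξ hξ
        obtain ⟨p', hp', hp0', hpp', hle⟩ := exists_idempotent_of_not_le hp (nsq_nonneg _)
          (nsq_nonneg _) hpξ hpη
        refine ⟨p', hp', hp0', by rw [← hpp', mul_assoc, hpr], η, hη, ?_⟩
        convert hle using 3
        push_cast
        ring
    refine hq0 (hS.eq_zero_of_unbounded hq hε fun n => ?_)
    -- The idempotent reached by `hstep` shrinks with `n`. Since `hstep` starts from an arbitrary
    -- `r` below `q`, gluing for fixed `n` restores the bound `n * ε` on all of `q`, as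
    -- `eq_zero_of_unbounded` requires.
    obtain ⟨I, π, s, ξ, hπ, hξ, hs⟩ := exists_mix_of_local (μ := μ) (X := X) (P := fun p ξ =>
        p * (q * const (n * ε)) ≤ p * (q * nsq μ (S ξ))) fun r hr hr0 => by
      by_cases h0 : r * q = 0
      · refine ⟨r, hr, hr0, hr.eq, 0, by rw [nsq_zero]; exact zero_le_one, ?_⟩
        rw [← mul_assoc, ← mul_assoc, h0, zero_mul, zero_mul]
      · obtain ⟨p, hp, hp0, hpr, ξ, hξ, hle⟩ := hstep n (r * q) (hr.mul hq) h0
          (by rw [mul_assoc, hq.eq])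
        have hpq : p * q = p := by rw [← hpr, mul_assoc, mul_assoc, hq.eq]
        refine ⟨p, hp, hp0, ?_, ξ, hξ, ?_⟩
        · rw [← hpr, mul_assoc, mul_right_comm, hr.eq]
        · rwa [← mul_assoc, ← mul_assoc, hpq]
    refine ⟨ξ, hξ, hπ.le fun i => (hs i).1.trans (le_of_eq ?_)⟩
    rw [mul_left_comm, mul_left_comm (π i), mul_nsq_map_congr S (hπ.1 i) (hs i).2]
  refine ⟨ξ, hξ, fun η hη => hπ.le fun i => ((hs i).1 η hη).trans (le_of_eq ?_)⟩
  rw [mul_add, mul_add, mul_nsq_map_congr S (hπ.1 i) (hs i).2]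

/-- The values at `1/(n+1)`-maximizers form a Cauchy sequence, so the supremum arises as a norm
limit and needs no order completeness. -/
theorem IsCyclicallyCompact.exists_maximum {S : X →ₗ[LInfty μ] X} (hS : IsCyclicallyCompact μ S) :
    ∃ h : LInfty μ, 0 ≤ h ∧ (∀ η : X, nsq μ (S η) ≤ h * nsq μ η) ∧
      ∀ n : ℕ, ∃ ξ : X, nsq μ ξ ≤ 1 ∧ h ≤ nsq μ (S ξ) + const (1 / ((n : ℝ) + 1)) := by
  have hpos : ∀ n : ℕ, (0 : ℝ) < 1 / ((n : ℝ) + 1) := fun n => by positivity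
  choose s hs1 hs2 using fun n : ℕ => hS.exists_almost_maximal (hpos n)
  have hcau : CauchySeq fun n => nsq μ (S (s n)) := by
    refine cauchySeq_of_le_tendsto_0 (fun n : ℕ => 1 / ((n : ℝ) + 1)) (fun m n N hm hn => ?_)
      tendsto_one_div_add_atTop_nhds_zero_nat
    rw [dist_eq_norm]
    have hmono : ∀ k : ℕ, N ≤ k → (const (1 / ((k : ℝ) + 1)) : LInfty μ) ≤
        const (1 / ((N : ℝ) + 1)) := fun k hk => const_mono (Nat.one_div_le_one_div hk)
    exact norm_sub_le_of_le (hpos N).le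
      ((hs2 n _ (hs1 m)).trans (add_le_add_right (hmono n hn) _))
      ((hs2 m _ (hs1 n)).trans (add_le_add_right (hmono m hm) _))
  obtain ⟨h, hh⟩ := cauchySeq_tendsto_of_complete hcau
  have hlim := ae_tendsto hh
  have hmax : ∀ η : X, nsq μ η ≤ 1 → nsq μ (S η) ≤ h := fun η hη => by
    have h1 : ∀ᵐ ω ∂μ, ∀ n : ℕ, nsq μ (S η) ω ≤ nsq μ (S (s n)) ω + ((1 / ((n : ℝ) + 1) : ℝ) : ℂ) :=
      ae_all_iff.2 fun n => by
        filter_upwards [le_iff.1 (hs2 n η hη), ae_add (nsq μ (S (s n))) (const (1 / ((n : ℝ) + 1))),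
          ae_const (μ := μ) (1 / ((n : ℝ) + 1))] with ω h1 h2 h3
        rwa [h2, h3] at h1
    rw [le_iff]
    filter_upwards [h1, hlim] with ω h2 h3
    have h4 : Filter.Tendsto (fun n : ℕ => ((1 / ((n : ℝ) + 1) : ℝ) : ℂ)) Filter.atTop (nhds 0) := by
      have := (Complex.continuous_ofReal.tendsto 0).comp
        (tendsto_one_div_add_atTop_nhds_zero_nat (𝕜 := ℝ))
      rwa [Complex.ofReal_zero] at this
    have h5 := h3.add h4
    rw [add_zero] at h5
    exact ge_of_tendsto' h5 h2
  have h0 : 0 ≤ h := (nsq_nonneg _).trans (hmax _ (hs1 0))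
  refine ⟨h, h0, nsq_map_le_mul h0 hmax, fun n => ⟨s n, hs1 n, ?_⟩⟩
  have h1 : ∀ᵐ ω ∂μ, ∀ m : ℕ, nsq μ (S (s m)) ω ≤ (nsq μ (S (s n)) + const (1 / ((n : ℝ) + 1)) : LInfty μ) ω :=
    ae_all_iff.2 fun m => le_iff.1 (hs2 n _ (hs1 m))
  rw [le_iff]
  filter_upwards [h1, hlim] with ω h2 h3
  exact le_of_tendsto' h3 h2

end Module

/-! ### Eigenvectors: first of `S²`, then of `S`, with normalization. -/

section Module

variable {Ω : Type u} [MeasurableSpace Ω] {μ : Measure Ω} {X : Type v} [AddCommGroup X]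
  [Module (LInfty μ) X] [LInftyInner μ X]

/-- Expand the left side using `⟨S²x, x⟩ = nsq (S x)` and bound `nsq (S²x)` by `h nsq (S x)`. The
defect in maximality thus controls the defect in `S²x = h x`. -/
theorem IsSelfAdjointOp.nsq_map_map_sub_le {S : X →ₗ[LInfty μ] X} (hsa : IsSelfAdjointOp μ S)
    {h : LInfty μ} (h0 : 0 ≤ h) (hS : ∀ η : X, nsq μ (S η) ≤ h * nsq μ η) (x : X) :
    nsq μ (S (S x) - h • x) ≤ h * (h * nsq μ x - nsq μ (S x)) := by
  have key : nsq μ (S (S x) - h • x) =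
      nsq μ (S (S x)) - 2 * h * nsq μ (S x) + h * h * nsq μ x := by
    have h1 : inner μ (S (S x)) x = nsq μ (S x) := hsa (S x) x
    have h2 : inner μ x (S (S x)) = nsq μ (S x) := (hsa x (S x)).symm
    simp only [nsq, inner_sub_left, inner_sub_right, inner_smul_left, inner_smul_right,
      star_of_nonneg h0] at h1 h2 ⊢
    rw [h1, h2]
    ring
  have h3 := hS (S x)
  rw [key]
  linear_combination h3

theorem nsq_sub_comm (ξ η : X) : nsq μ (ξ - η) = nsq μ (η - ξ) := by
  simp only [nsq, inner_sub_left, inner_sub_right]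
  ring

theorem eq_of_nsq_sub_le {ξ η : X} {c : LInfty μ} (hc : 0 ≤ c)
    (h : ∀ ε : ℝ, 0 < ε → nsq μ (ξ - η) ≤ c * const ε) : ξ = η := by
  rw [← sub_eq_zero, ← nsq_eq_zero (μ := μ)]
  refine le_antisymm (le_of_forall_le_add_mul_const hc fun ε hε => ?_) (nsq_nonneg _)
  simpa using h ε hε

/-- The inverse of `√(nsq θ)` may be unbounded, so normalization is done only where `nsq θ ≥
1/(n+1)`, for an `n` making this region meet `q`. If `q` misses the support, the zero vector serves.
-/
theorem exists_normalized_of_ne_zero {θ : X} {q : LInfty μ} (hq : IsIdempotentElem q)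
    (hq0 : q ≠ 0) : ∃ p : LInfty μ, IsIdempotentElem p ∧ p ≠ 0 ∧ p * q = p ∧ ∃ φ : X,
      nsq μ φ ≤ 1 ∧ (∃ g : LInfty μ, φ = g • θ) ∧ p * nsq μ φ = p * supp (nsq μ θ) := by
  set a := nsq μ θ with ha
  have ha0 := nsq_nonneg (μ := μ) θ
  by_cases h0 : q * supp a = 0
  · refine ⟨q, hq, hq0, hq.eq, 0, by rw [nsq_zero]; exact zero_le_one, ⟨0, by simp⟩, ?_⟩
    rw [h0, nsq_zero, mul_zero]
  have hs : ∀ n : ℕ, MeasurableSet {z : ℂ | 1 / ((n : ℝ) + 1) ≤ ‖z‖} := fun n =>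
    measurableSet_le measurable_const measurable_norm
  obtain ⟨n, hn⟩ : ∃ n : ℕ, q * ind {z : ℂ | 1 / ((n : ℝ) + 1) ≤ ‖z‖} a ≠ 0 := by
    by_contra! hcon
    refine h0 (eq_zero_iff.2 ?_)
    filter_upwards [ae_all_iff.2 fun n => eq_zero_iff.1 (hcon n), ae_mul q (supp a), ae_supp a,
      ae_all_iff.2 fun n => ae_ind (hs n) a,
      ae_all_iff.2 fun n : ℕ => ae_mul q (ind {z : ℂ | 1 / ((n : ℝ) + 1) ≤ ‖z‖} a)]
      with ω h1 h2 h3 h4 h5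
    rw [h2]
    by_cases h6 : a ω = 0
    · rw [h3.2 h6, mul_zero]
    · obtain ⟨n, hn⟩ := exists_nat_one_div_lt (norm_pos_iff.2 h6)
      have h7 := h1 n
      rw [h5, (h4 n).1 hn.le, mul_one] at h7
      rw [h7, zero_mul]
  set e := ind {z : ℂ | 1 / ((n : ℝ) + 1) ≤ ‖z‖} a
  have hδ : (0 : ℝ) < 1 / ((n : ℝ) + 1) := by positivity
  set g := mcomp (fun z => if 1 / ((n : ℝ) + 1) ≤ ‖z‖ then (((√‖z‖)⁻¹ : ℝ) : ℂ) else 0) a with hg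
  have hgae : ∀ᵐ ω ∂μ, g ω = if 1 / ((n : ℝ) + 1) ≤ ‖a ω‖ then (((√‖a ω‖)⁻¹ : ℝ) : ℂ) else 0 := by
    refine ae_mcomp (Measurable.ite (hs n) (by fun_prop) measurable_const)
      (C := (√(1 / ((n : ℝ) + 1)))⁻¹) (fun z => ?_) _
    split_ifs with hz
    · rw [Complex.norm_real, Real.norm_of_nonneg (by positivity)]
      have := Real.sqrt_pos.2 hδ
      gcongr
    · rw [norm_zero]
      positivity
  have hg0 : 0 ≤ g := by
    rw [nonneg_iff]
    filter_upwards [hgae] with ω h1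
    rw [h1]
    split_ifs
    · exact_mod_cast inv_nonneg.2 (Real.sqrt_nonneg _)
    · exact le_rfl
  have hge : g * g * a = e := by
    rw [eq_iff]
    filter_upwards [hgae, ae_mul (g * g) a, ae_mul g g, ae_ind (hs n) a, nonneg_iff.1 ha0]
      with ω h1 h2 h3 h4 h5
    rw [h2, h3, h1]
    split_ifs with h6
    · rw [h4.1 h6]
      nth_rw 3 [Complex.eq_coe_norm_of_nonneg h5]
      norm_cast
      have : 0 < ‖a ω‖ := hδ.trans_le h6
      rw [← mul_inv, Real.mul_self_sqrt this.le, inv_mul_cancel₀ this.ne']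
    · rw [h4.2 h6]
      simp
  have he : IsIdempotentElem e := isIdempotentElem_ind (hs n) a
  have hφ : nsq μ (g • θ) = e := by rw [nsq_smul_of_nonneg hg0, ← ha, hge]
  refine ⟨q * e, hq.mul he, hn, by rw [mul_right_comm, hq.eq], g • θ,
    hφ ▸ le_one_of_isIdempotentElem he, ⟨g, rfl⟩, ?_⟩
  have h1 : e * supp a = e := by
    rw [← hge, mul_assoc (g * g), mul_comm a, supp_mul_self]
  rw [hφ, mul_assoc, mul_assoc, h1, he.eq]

variable [HilbertKaplanskyModule μ X]

/-- For `h` the square of the vector norm of `S`, approximate maximizers of `S` converge to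
eigenvectors of `S²` after multiplication by `h`. -/
theorem IsCyclicallyCompact.exists_approx {S : X →ₗ[LInfty μ] X} (hS : IsCyclicallyCompact μ S)
    (hsa : IsSelfAdjointOp μ S) :
    ∃ (h : LInfty μ) (ψ : X), 0 ≤ h ∧ (∀ η : X, nsq μ (S η) ≤ h * nsq μ η) ∧
      ∀ ε : ℝ, 0 < ε → ∃ ζ : X, nsq μ ζ ≤ 1 ∧ h ≤ nsq μ (S ζ) + const ε ∧
        nsq μ (ψ - h • ζ) ≤ 4 * h * const ε := by
  obtain ⟨h, h0, hle, hmax⟩ := hS.exists_maximum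
  choose s hs1 hs2 using hmax
  obtain ⟨ν, ζ, χ, hν, -, hlt, hmix, hζ1, hχ⟩ := hS.exists_convergent hs1
  have hζ2 : ∀ k : ℕ, h ≤ nsq μ (S (ζ k)) + const (1 / ((k : ℝ) + 1)) := fun k => by
    refine (hν k).le fun n => ?_
    by_cases hn : ν k n = 0
    · simp [hn]
    · rw [mul_add, mul_nsq_map_congr S ((hν k).1 n) (hmix k n), ← mul_add]
      refine mul_le_mul_of_nonneg_left ((hs2 n).trans (add_le_add_right (const_mono ?_) _))
        (nonneg_of_isIdempotentElem ((hν k).1 n))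
      exact Nat.one_div_le_one_div (hlt k n hn)
  -- As `S (ζ k)` tends to `χ` and `S (S (ζ k)) - h • ζ k` tends to `0`, the vector `S χ` is the
  -- limit of `h • ζ k`.
  refine ⟨h, S χ, h0, hle, fun ε hε => ?_⟩
  obtain ⟨N, hN⟩ := hχ.nsq_le hε
  obtain ⟨k, hk⟩ := exists_nat_one_div_lt hε
  have hζn : h ≤ nsq μ (S (ζ (max N k))) + const ε :=
    (hζ2 _).trans (add_le_add_right
      (const_mono ((Nat.one_div_le_one_div (le_max_right N k)).trans hk.le)) _)
  refine ⟨ζ (max N k), hζ1 _, hζn, ?_⟩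
  have hz := hζ1 (max N k)
  have h1 := hN _ (le_max_left N k)
  generalize ζ (max N k) = z at h1 hζn hz ⊢
  -- `S χ - h z` splits as `S (χ - S z) + (S (S z) - h z)`. Each part has square at most `h ε`, and
  -- `nsq_add_le` doubles both, whence the factor `4`.
  have h2 := nsq_add_le (μ := μ) (S (χ - S z)) (S (S z) - h • z)
  rw [map_sub, sub_add_sub_cancel, ← map_sub] at h2
  have h4 : nsq μ (S (S z) - h • z) ≤ h * const ε := by
    refine (hsa.nsq_map_map_sub_le h0 hle z).trans (mul_le_mul_of_nonneg_left ?_ h0)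
    have := mul_le_mul_of_nonneg_left hz h0
    linear_combination this + hζn
  have h3 := (hle (χ - S z)).trans (mul_le_mul_of_nonneg_left
    ((nsq_sub_comm (μ := μ) χ (S z)).le.trans h1) h0)
  linear_combination h2 + h3 + h3 + h4 + h4

/-- Both claims pass to the limit from the near-maximizers `ζ` with `ψ` close to `h • ζ`. The last
inequality is not sharp; it serves to show that `ψ` is nonzero wherever `h` is. -/
theorem IsCyclicallyCompact.exists_sq_eigenvector {S : X →ₗ[LInfty μ] X}
    (hS : IsCyclicallyCompact μ S) (hsa : IsSelfAdjointOp μ S) :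
    ∃ (h : LInfty μ) (ψ : X), 0 ≤ h ∧ (∀ η : X, nsq μ (S η) ≤ h * nsq μ η) ∧
      S (S ψ) = h • ψ ∧ h * h ≤ 2 * nsq μ ψ := by
  obtain ⟨h, ψ, h0, hle, happ⟩ := hS.exists_approx hsa
  have hh0 := mul_nonneg h0 h0
  refine ⟨h, ψ, h0, hle, ?_, ?_⟩
  · refine eq_of_nsq_sub_le (c := 8 * (h * h * h) + 2 * (h * h * h)) ?_ fun ε hε => ?_
    · have := nsmul_nonneg (mul_nonneg hh0 h0) 10
      rw [nsmul_eq_mul, Nat.cast_ofNat] at this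
      linear_combination this
    obtain ⟨ζ, hζ, hζh, hψ⟩ := happ ε hε
    have h1 := nsq_add_le (μ := μ) (S (S (ψ - h • ζ)) - h • (ψ - h • ζ)) (h • (S (S ζ) - h • ζ))
    have h2 : S (S (ψ - h • ζ)) - h • (ψ - h • ζ) + h • (S (S ζ) - h • ζ) = S (S ψ) - h • ψ := by
      simp only [map_sub, map_smul, smul_sub]
      abel
    rw [h2, nsq_smul_of_nonneg h0] at h1
    have h3 := hsa.nsq_map_map_sub_le h0 hle (ψ - h • ζ)
    have h4 := mul_nonneg h0 (nsq_nonneg (μ := μ) (S (ψ - h • ζ)))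
    have h5 := mul_le_mul_of_nonneg_left hψ hh0
    have h6 : h * nsq μ ζ - nsq μ (S ζ) ≤ const ε := by
      have := mul_le_mul_of_nonneg_left hζ h0
      linear_combination this + hζh
    have h7 := mul_le_mul_of_nonneg_left
      ((hsa.nsq_map_map_sub_le h0 hle ζ).trans (mul_le_mul_of_nonneg_left h6 h0)) hh0
    linear_combination h1 + h3 + h3 + h4 + h4 + h5 + h5 + h7 + h7
  · refine le_of_forall_le_add_mul_const (c := h + 8 * h) ?_ fun ε hε => ?_
    · have := nsmul_nonneg h0 9
      rw [nsmul_eq_mul, Nat.cast_ofNat] at this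
      linear_combination this
    obtain ⟨ζ, hζ, hζh, hψ⟩ := happ ε hε
    have h1 := nsq_sub_le (μ := μ) ψ (ψ - h • ζ)
    rw [sub_sub_cancel, nsq_smul_of_nonneg h0] at h1
    have h2 := mul_le_mul_of_nonneg_left (hζh.trans (add_le_add_left (hle ζ) _)) h0
    linear_combination h2 + h1 + hψ + hψ

/-- Normalization of an eigenvector: it can be replaced by one whose square norm is an
idempotent. -/
theorem exists_normalized_eigenvector (S : X →ₗ[LInfty μ] X) {l : LInfty μ} {θ : X}
    (h : S θ = l • θ) : ∃ φ : X, S φ = l • φ ∧ nsq μ φ = supp (nsq μ θ) := by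
  obtain ⟨I, π, s, φ, hπ, -, hs⟩ := exists_mix_of_local (μ := μ) (X := X) (P := fun p φ =>
    (∃ g : LInfty μ, φ = g • θ) ∧ p * nsq μ φ = p * supp (nsq μ θ))
    fun q hq hq0 => exists_normalized_of_ne_zero hq hq0
  refine ⟨φ, hπ.ext fun i => ?_, ?_⟩
  · obtain ⟨⟨⟨g, hg⟩, -⟩, hφ⟩ := hs i
    rw [← map_smul, smul_comm, hφ, hg, map_smul, map_smul, h, smul_comm l, smul_comm l]
  · refine sub_eq_zero.1 (hπ.eq_zero fun i => ?_)
    rw [mul_sub, mul_nsq_congr (hπ.1 i) (hs i).2, (hs i).1.2, sub_self]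

/-- A self-adjoint cyclically compact operator has an eigenvector, normalized on the support of its
vector norm, whose eigenvalue has the vector norm of the operator as its modulus. -/
theorem IsCyclicallyCompact.exists_eigenvector {S : X →ₗ[LInfty μ] X}
    (hS : IsCyclicallyCompact μ S) (hsa : IsSelfAdjointOp μ S) :
    ∃ (h l : LInfty μ) (φ : X), 0 ≤ h ∧ (∀ η : X, nsq μ (S η) ≤ h * nsq μ η) ∧ star l = l ∧
      l * l = h ∧ S φ = l • φ ∧ nsq μ φ = supp h := by
  obtain ⟨h, ψ, h0, hle, hψ, hhψ⟩ := hS.exists_sq_eigenvector hsa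
  set m := sqrt h
  have hmm : m * m = h := sqrt_mul_sqrt h0
  have hm : star m = m := star_of_nonneg (sqrt_nonneg h)
  -- From `(S - m)(S + m)ψ = 0`, the vector `ψ₁ = (S + m)ψ` has eigenvalue `m`. Off its support `e`,
  -- `S ψ = -mψ`, so `ψ` itself has eigenvalue `-m` there; `θ` and `l` join the two cases.
  obtain ⟨ψ₁, hψ₁⟩ : ∃ x, x = S ψ + m • ψ := ⟨_, rfl⟩
  have hSψ₁ : S ψ₁ = m • ψ₁ := by
    rw [hψ₁, map_add, map_smul, hψ, smul_add, smul_smul, hmm, add_comm]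
  obtain ⟨e, hedef⟩ : ∃ e, e = supp (nsq μ ψ₁) := ⟨_, rfl⟩
  have he : IsIdempotentElem e := hedef ▸ isIdempotentElem_supp _
  have heψ₁ : e • ψ₁ = ψ₁ := smul_eq_self_of_nsq_eq he (hedef ▸ supp_mul_self _)
  have hSψ : (1 - e) • S ψ = -((1 - e) • m • ψ) := by
    rw [← add_eq_zero_iff_eq_neg, ← smul_add, ← hψ₁, sub_smul, heψ₁, one_smul, sub_self]
  obtain ⟨l, hl⟩ : ∃ l, l = e * m + -((1 - e) * m) := ⟨_, rfl⟩
  obtain ⟨θ, hθ⟩ : ∃ θ, θ = e • ψ₁ + (1 - e) • ψ := ⟨_, rfl⟩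
  have hSθ : S θ = l • θ := by
    have h1 : l * e = e * m := by
      rw [hl]
      linear_combination 2 * m * he.eq
    have h2 : l * (1 - e) = -((1 - e) * m) := by
      rw [hl]
      linear_combination -2 * m * he.eq
    rw [hθ, map_add, map_smul, map_smul, hSψ₁, hSψ, smul_add, smul_smul, smul_smul, smul_smul,
      smul_smul, h1, h2, neg_smul]
  have hnθ : nsq μ θ = e * nsq μ ψ₁ + (1 - e) * nsq μ ψ := by
    rw [hθ]
    simp only [nsq, inner_add_left, inner_add_right, inner_smul_left, inner_smul_right,
      star_of_isIdempotentElem he, star_of_isIdempotentElem he.one_sub]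
    linear_combination (inner μ ψ₁ ψ₁ - inner μ ψ₁ ψ - inner μ ψ ψ₁ + inner μ ψ ψ) * he.eq
  obtain ⟨φ, hφ, hnφ⟩ := exists_normalized_eigenvector S hSθ
  -- Where `h ≠ 0`, either `ψ₁ ≠ 0`, or `θ` equals `ψ`, which is nonzero because `h² ≤ 2 nsq ψ`.
  have hsupp : supp h * supp (nsq μ θ) = supp h := by
    rw [hnθ, eq_iff]
    filter_upwards [ae_supp h, ae_supp (e * nsq μ ψ₁ + (1 - e) * nsq μ ψ),
      ae_mul (supp h) (supp (e * nsq μ ψ₁ + (1 - e) * nsq μ ψ)), ae_supp (nsq μ ψ₁),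
      ae_add (e * nsq μ ψ₁) ((1 - e) * nsq μ ψ), ae_mul e (nsq μ ψ₁), ae_mul (1 - e) (nsq μ ψ),
      ae_sub 1 e, ae_one (μ := μ), le_iff.1 hhψ, ae_mul h h, ae_mul 2 (nsq μ ψ),
      nonneg_iff.1 h0] with ω h1 h2 h3 h4 h5 h6 h7 h8 h9 h10 h11 h12 h13
    rw [h3]
    by_cases hω : h ω = 0
    · rw [h1.2 hω, zero_mul]
    rw [h1.1 hω, one_mul]
    refine h2.1 ?_
    rw [h5, h6, h7, h8, h9]
    by_cases hω1 : nsq μ ψ₁ ω = 0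
    · rw [show e ω = 0 from by rw [hedef, h4.2 hω1]]
      intro h14
      simp only [zero_mul, sub_zero, one_mul, zero_add] at h14
      rw [h11, h12, h14, mul_zero] at h10
      have h15 : 0 < h ω := lt_of_le_of_ne h13 (Ne.symm hω)
      exact absurd h10 (mul_pos h15 h15).not_ge
    · rw [show e ω = 1 from by rw [hedef, h4.1 hω1]]
      simpa using hω1
  -- The support of `θ` contains that of `h`; cutting by `supp h` makes them agree.
  refine ⟨h, l, supp h • φ, h0, hle, ?_, ?_, ?_, ?_⟩
  · rw [hl, star_add_eq, star_neg_eq, star_mul_eq, star_mul_eq, hm, star_of_isIdempotentElem he,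
      star_of_isIdempotentElem he.one_sub]
  · rw [hl, ← hmm]
    linear_combination 4 * m * m * he.eq
  · rw [map_smul, hφ, smul_comm]
  · rw [nsq_smul_of_isIdempotentElem (isIdempotentElem_supp h), hnφ, hsupp]

end Module

/-! ### Deflation: orthogonality and decay of the eigenvalues. -/

section Module

variable {Ω : Type u} [MeasurableSpace Ω] {μ : Measure Ω} {X : Type v} [AddCommGroup X]
  [Module (LInfty μ) X] [LInftyInner μ X]

theorem tensor_apply (ξ η ζ : X) : tensor μ ξ η ζ = inner μ ζ η • ξ := rfl

theorem normInf_le_of_nsq_le {ξ η : X} (h : nsq μ ξ ≤ nsq μ η) : normInf μ ξ ≤ normInf μ η :=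
  Real.sqrt_le_sqrt (norm_le_of_le_const (nsq_nonneg ξ) (norm_nonneg _)
    (h.trans (le_const_of_norm_le (nsq_nonneg η) le_rfl)))

theorem smul_self_of_nsq_isIdempotentElem {φ : X} (h : IsIdempotentElem (nsq μ φ)) :
    nsq μ φ • φ = φ :=
  smul_eq_self_of_nsq_eq h h.eq

/-- Bessel's inequality for one normalized vector. -/
theorem nsq_sub_inner_smul_le {φ : X} (h : IsIdempotentElem (nsq μ φ)) (ζ : X) :
    nsq μ (ζ - inner μ ζ φ • φ) ≤ nsq μ ζ := by
  have h1 : nsq μ φ * inner μ ζ φ = inner μ ζ φ := by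
    conv_rhs => rw [← smul_self_of_nsq_isIdempotentElem h]
    rw [inner_smul_right, star_of_isIdempotentElem h]
  have h2 : inner μ φ ζ = star (inner μ ζ φ) := (inner_conj _ _).symm
  have h3 := star_mul_self_nonneg' (inner μ ζ φ)
  rw [← sub_nonneg]
  convert h3 using 1
  simp only [nsq, inner_sub_left, inner_sub_right, inner_smul_left, inner_smul_right] at h1 h2 ⊢
  rw [h2]
  linear_combination (-star (inner μ ζ φ)) * h1

theorem IsSelfAdjointOp.sub_smul_tensor {S : X →ₗ[LInfty μ] X} (hS : IsSelfAdjointOp μ S)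
    {l : LInfty μ} (hl : star l = l) (φ : X) :
    IsSelfAdjointOp μ (S - l • tensor μ φ φ) := fun ξ η => by
  simp only [LinearMap.sub_apply, LinearMap.smul_apply, tensor_apply, inner_sub_left,
    inner_sub_right, inner_smul_left, inner_smul_right, hl, inner_conj, hS ξ η]
  ring

theorem sub_smul_tensor_apply {S : X →ₗ[LInfty μ] X} {l : LInfty μ} {φ : X}
    (h : S φ = l • φ) (ζ : X) :
    (S - l • tensor μ φ φ) ζ = S (ζ - inner μ ζ φ • φ) := by
  rw [map_sub, map_smul, h, LinearMap.sub_apply, LinearMap.smul_apply, tensor_apply, smul_comm]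

/-- The new operator is `S` composed with `1 - φ ⊗ φ`, which does not increase norms and so keeps
sets bounded. Sums of cyclically compact operators need not be considered. -/
theorem IsCyclicallyCompact.sub_smul_tensor {S : X →ₗ[LInfty μ] X} (hS : IsCyclicallyCompact μ S)
    {l : LInfty μ} {φ : X} (hφ : IsIdempotentElem (nsq μ φ)) (h : S φ = l • φ) :
    IsCyclicallyCompact μ (S - l • tensor μ φ φ) := by
  rintro C ⟨M, hM⟩
  obtain ⟨K, hK, hSK⟩ := hS ((fun ζ => ζ - inner μ ζ φ • φ) '' C) ⟨M, by
    rintro _ ⟨ζ, hζ, rfl⟩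
    exact (normInf_le_of_nsq_le (nsq_sub_inner_smul_le hφ ζ)).trans (hM ζ hζ)⟩
  refine ⟨K, hK, ?_⟩
  rintro _ ⟨ζ, hζ, rfl⟩
  rw [sub_smul_tensor_apply h]
  exact hSK (Set.mem_image_of_mem _ (Set.mem_image_of_mem _ hζ))

/-- Successive deflation of an operator: `φ n` is a normalized eigenvector of `S n` for the
eigenvalue `l n`, `h n = |l n|²` bounds `S n`, and `S (n + 1)` is obtained by removing the
corresponding rank one operator. -/
structure IsDeflation (S : ℕ → X →ₗ[LInfty μ] X) (h l : ℕ → LInfty μ) (φ : ℕ → X) : Prop where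
  succ : ∀ n, S (n + 1) = S n - l n • tensor μ (φ n) (φ n)
  selfAdjoint : ∀ n, IsSelfAdjointOp μ (S n)
  nonneg : ∀ n, 0 ≤ h n
  nsq_map_le : ∀ n η, nsq μ (S n η) ≤ h n * nsq μ η
  star_eq : ∀ n, star (l n) = l n
  mul_self : ∀ n, l n * l n = h n
  map_eq : ∀ n, S n (φ n) = l n • φ n
  nsq_eq : ∀ n, nsq μ (φ n) = supp (h n)

namespace IsDeflation

variable {S : ℕ → X →ₗ[LInfty μ] X} {h l : ℕ → LInfty μ} {φ : ℕ → X}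

theorem isIdempotentElem_nsq (D : IsDeflation S h l φ) (n : ℕ) :
    IsIdempotentElem (nsq μ (φ n)) := D.nsq_eq n ▸ isIdempotentElem_supp _

theorem supp_smul (D : IsDeflation S h l φ) (n : ℕ) : supp (h n) • φ n = φ n := by
  rw [← D.nsq_eq, smul_self_of_nsq_isIdempotentElem (D.isIdempotentElem_nsq n)]

/-- Self-adjointness gives `l k ⟨φ k, ξ⟩ = ⟨S k (φ k), ξ⟩ = 0`. The factor `l k` can be cancelled
because `φ k` lives on the support of `h k = (l k)²`. -/
theorem inner_eq_zero_of_map_eq_zero (D : IsDeflation S h l φ) {k : ℕ} {ξ : X} (hξ : S k ξ = 0) :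
    inner μ (φ k) ξ = 0 := by
  have h1 : l k * inner μ (φ k) ξ = 0 := by
    rw [← inner_smul_left, ← D.map_eq, D.selfAdjoint, hξ, inner_zero_right]
  have h2 : h k * inner μ (φ k) ξ = 0 := by rw [← D.mul_self, mul_assoc, h1, mul_zero]
  rw [← D.supp_smul, inner_smul_left]
  exact supp_mul_eq_zero h2

theorem map_eq_zero (D : IsDeflation S h l φ) {i k : ℕ} (hik : i < k) : S k (φ i) = 0 := by
  induction k, hik using Nat.le_induction with
  | base =>
    rw [D.succ, LinearMap.sub_apply, LinearMap.smul_apply, tensor_apply, D.map_eq]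
    change l i • φ i - l i • nsq μ (φ i) • φ i = 0
    rw [smul_self_of_nsq_isIdempotentElem (D.isIdempotentElem_nsq i), sub_self]
  | succ k _ ih =>
    rw [D.succ, LinearMap.sub_apply, LinearMap.smul_apply, tensor_apply, ih, ← inner_conj,
      D.inner_eq_zero_of_map_eq_zero ih, star_zero_eq, zero_smul, smul_zero, sub_zero]

theorem inner_eq_zero (D : IsDeflation S h l φ) {i k : ℕ} (hik : i ≠ k) :
    inner μ (φ i) (φ k) = 0 := by
  rcases hik.lt_or_gt with h1 | h1
  · rw [← inner_conj, D.inner_eq_zero_of_map_eq_zero (D.map_eq_zero h1), star_zero_eq]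
  · exact D.inner_eq_zero_of_map_eq_zero (D.map_eq_zero h1)

theorem eq_add_sum (D : IsDeflation S h l φ) (n : ℕ) :
    S 0 = S n + ∑ i ∈ Finset.range n, l i • tensor μ (φ i) (φ i) := by
  induction n with
  | zero => simp
  | succ n ih =>
    rw [ih, D.succ, Finset.sum_range_succ]
    abel

theorem map_zero_eq (D : IsDeflation S h l φ) (n : ℕ) : S 0 (φ n) = l n • φ n := by
  rw [D.eq_add_sum n, LinearMap.add_apply, D.map_eq, LinearMap.sum_apply, Finset.sum_eq_zero,
    add_zero]
  intro i hi
  rw [LinearMap.smul_apply, tensor_apply, D.inner_eq_zero (Finset.mem_range.1 hi).ne', zero_smul,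
    smul_zero]

/-- `h (n + 1)` is the value of `nsq ∘ S (n + 1)` at `φ (n + 1)`, and `S (n + 1)` is `S n` after a
contraction. -/
theorem antitone (D : IsDeflation S h l φ) : Antitone h := by
  refine antitone_nat_of_succ_le fun n => ?_
  have h1 : nsq μ (S (n + 1) (φ (n + 1))) ≤ h n * nsq μ (φ (n + 1)) := by
    rw [D.succ, sub_smul_tensor_apply (D.map_eq n)]
    exact (D.nsq_map_le n _).trans (mul_le_mul_of_nonneg_left
      (nsq_sub_inner_smul_le (D.isIdempotentElem_nsq n) _) (D.nonneg n))
  rw [D.map_eq, nsq_smul, D.star_eq, D.mul_self, D.nsq_eq, mul_comm, supp_mul_self] at h1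
  refine h1.trans ((mul_le_mul_of_nonneg_left (le_one_of_isIdempotentElem
    (isIdempotentElem_supp _)) (D.nonneg n)).trans (mul_one _).le)

theorem supp_mul_supp_succ (D : IsDeflation S h l φ) (n : ℕ) :
    supp (h n) * supp (h (n + 1)) = supp (h (n + 1)) := by
  rw [eq_iff]
  filter_upwards [ae_mul (supp (h n)) (supp (h (n + 1))), ae_supp (h n), ae_supp (h (n + 1)),
    nonneg_iff.1 (D.nonneg (n + 1)), le_iff.1 (D.antitone n.le_succ)] with ω h1 h2 h3 h4 h5
  rw [h1]
  by_cases h0 : h n ω = 0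
  · rw [h3.2 (le_antisymm (h0 ▸ h5) h4), mul_zero]
  · rw [h2.1 h0, one_mul]

theorem ae_norm (D : IsDeflation S h l φ) (n : ℕ) : ∀ᵐ ω ∂μ, ‖l n ω‖ = √(h n ω).re := by
  filter_upwards [eq_iff.1 (D.mul_self n), ae_mul (l n) (l n), eq_iff.1 (D.star_eq n),
    ae_star (l n)] with ω h1 h2 h3 h4
  rw [h4] at h3
  rw [← h1, h2]
  obtain ⟨r, hr⟩ := Complex.conj_eq_iff_real.1 h3
  rw [hr, ← Complex.ofReal_mul, Complex.ofReal_re, Complex.norm_real, Real.sqrt_mul_self_eq_abs,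
    Real.norm_eq_abs]

theorem smul_eq_zero (D : IsDeflation S h l φ) {p : LInfty μ} (hp : IsIdempotentElem p) {n : ℕ}
    (hpn : p * supp (h n) = 0) : p • S n = 0 := by
  ext ζ
  rw [LinearMap.smul_apply, LinearMap.zero_apply, ← nsq_eq_zero (μ := μ),
    nsq_smul_of_isIdempotentElem hp]
  refine le_antisymm ?_ (mul_nonneg (nonneg_of_isIdempotentElem hp) (nsq_nonneg _))
  refine (mul_le_mul_of_nonneg_left (D.nsq_map_le n ζ) (nonneg_of_isIdempotentElem hp)).trans ?_
  rw [← supp_mul_self (h n), ← mul_assoc, ← mul_assoc, hpn, zero_mul, zero_mul]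

variable [HilbertKaplanskyModule μ X]

/-- On this region the orthogonal vectors `S 0 (φ n)` have square `h n ≥ ε`, and no cyclic
subsequence of such vectors can converge. -/
theorem indic_eq_zero (D : IsDeflation S h l φ) (hS : IsCyclicallyCompact μ (S 0)) {ε : ℝ}
    (hε : 0 < ε) : (indic {ω | ∀ n, ε ≤ (h n ω).re} : LInfty μ) = 0 := by
  have hA : MeasurableSet {ω | ∀ n, ε ≤ (h n ω).re} := by
    rw [Set.ofPred_forall]
    exact MeasurableSet.iInter fun n => measurableSet_le measurable_const
      (Complex.measurable_re.comp (Lp.stronglyMeasurable (h n)).measurable)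
  set q : LInfty μ := indic {ω | ∀ n, ε ≤ (h n ω).re}
  have hq : IsIdempotentElem q := isIdempotentElem_indic hA
  have hq0 := nonneg_of_isIdempotentElem hq
  have hqh : ∀ n, q * const ε ≤ q * h n := fun n => by
    rw [le_iff]
    filter_upwards [ae_indic (μ := μ) hA, ae_mul q (const ε), ae_mul q (h n),
      ae_const (μ := μ) ε, nonneg_iff.1 (D.nonneg n)] with ω h1 h2 h3 h4 h5
    rw [h2, h3, h4]
    by_cases hω : ω ∈ {ω | ∀ n, ε ≤ (h n ω).re}
    · rw [show q ω = 1 from h1.1 hω, one_mul, one_mul]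
      exact Complex.le_def.2 ⟨hω n, (Complex.nonneg_iff.1 h5).2⟩
    · rw [show q ω = 0 from h1.2 hω, zero_mul, zero_mul]
  obtain ⟨ν, ζ, χ, hν, hlt, -, hmix, -, hχ⟩ := hS.exists_convergent (s := φ) fun n => by
    rw [D.nsq_eq]
    exact le_one_of_isIdempotentElem (isIdempotentElem_supp _)
  have hmap : ∀ (p : LInfty μ) (k m : ℕ), p * ν k m = p → p • S 0 (ζ k) = p • S 0 (φ m) :=
    fun p k m hp => by
      rw [← map_smul, ← map_smul, ← hp, mul_smul, mul_smul, hmix]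
  have hlow : ∀ k, q * const ε ≤ q * nsq μ (S 0 (ζ k)) := fun k => by
    refine (hν k).le fun n => ?_
    have hνn := (hν k).1 n
    rw [mul_left_comm _ q (nsq μ _), mul_nsq_congr hνn (hmap _ k n hνn.eq),
      mul_left_comm q (ν k n), D.map_zero_eq, nsq_smul, D.star_eq, D.mul_self, D.nsq_eq,
      mul_comm (h n), supp_mul_self]
    exact mul_le_mul_of_nonneg_left (hqh n) (nonneg_of_isIdempotentElem hνn)
  -- On each common part, `ζ k` and `ζ (k + 1)` coincide with some `φ m` and `φ n` with `m < n`, so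
  -- their images are orthogonal.
  have horth : ∀ k, inner μ (S 0 (ζ k)) (S 0 (ζ (k + 1))) = 0 := fun k => by
    refine (hν k).eq_zero fun m => (hν (k + 1)).eq_zero fun n => ?_
    by_cases h0 : ν k m * ν (k + 1) n = 0
    · rw [← mul_assoc, mul_comm (ν (k + 1) n), h0, zero_mul]
    · have hm := (hν k).1 m
      have hn := (hν (k + 1)).1 n
      rw [← mul_assoc, mul_comm (ν (k + 1) n), mul_inner_congr (hm.mul hn)
        (hmap _ k m (by rw [mul_right_comm, hm.eq])) (hmap _ (k + 1) n (by rw [mul_assoc, hn.eq])),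
        D.map_zero_eq, D.map_zero_eq, inner_smul_left, inner_smul_right,
        D.inner_eq_zero (hlt k m n h0).ne]
      simp
  -- With tolerance `ε/8` the squared distance of consecutive images is at most `4 · ε/8 = ε/2`. By
  -- orthogonality it is at least `ε` on `q`.
  obtain ⟨N, hN⟩ := hχ.nsq_le (show 0 < ε / 8 by positivity)
  have h1 := nsq_sub_le (μ := μ) (S 0 (ζ N) - χ) (S 0 (ζ (N + 1)) - χ)
  rw [sub_sub_sub_cancel_right] at h1
  have h2 : nsq μ (S 0 (ζ N) - S 0 (ζ (N + 1))) =
      nsq μ (S 0 (ζ N)) + nsq μ (S 0 (ζ (N + 1))) := by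
    have h3 : inner μ (S 0 (ζ (N + 1))) (S 0 (ζ N)) = 0 := by
      rw [← inner_conj, horth, star_zero_eq]
    simp only [nsq, inner_sub_left, inner_sub_right, h3, horth]
    ring
  have h3 := hN N le_rfl
  have h4 := hN (N + 1) N.le_succ
  have h5 : nsq μ (S 0 (ζ N)) ≤ const (ε / 2) := by
    have h6 : (const (ε / 2) : LInfty μ) = 4 * const (ε / 8) := by
      have h7 : (4 : LInfty μ) = const 4 := by
        rw [show (4 : ℝ) = 2 * 2 by norm_num, const_mul, const_two]
        norm_num
      rw [h7, ← const_mul]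
      congr 1
      ring
    have h8 := nsq_nonneg (μ := μ) (S 0 (ζ (N + 1)))
    rw [h6]
    rw [h2] at h1
    linear_combination h1 + h8 + h3 + h3 + h4 + h4
  have h6 := (hlow N).trans (mul_le_mul_of_nonneg_left h5 hq0)
  rw [show ε = ε / 2 + ε / 2 by ring, const_add, add_halves, mul_add] at h6
  have h7 : q * const (ε / 2) ≤ 0 := by simpa using h6
  have h8 := mul_le_mul_of_nonneg_right h7 (const_nonneg (μ := μ) (a := 2 / ε) (by positivity))
  rw [mul_assoc, ← const_mul, show ε / 2 * (2 / ε) = 1 by field_simp, const_one, mul_one,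
    zero_mul] at h8
  exact le_antisymm h8 hq0

theorem ae_exists_lt (D : IsDeflation S h l φ) (hS : IsCyclicallyCompact μ (S 0)) :
    ∀ᵐ ω ∂μ, ∀ ε : ℝ, 0 < ε → ∃ n, (h n ω).re < ε := by
  have h1 : ∀ j : ℕ, ∀ᵐ ω ∂μ, ∃ n, (h n ω).re < 1 / ((j : ℝ) + 1) := fun j => by
    have hj : (0 : ℝ) < 1 / ((j : ℝ) + 1) := by positivity
    have hA : MeasurableSet {ω | ∀ n, 1 / ((j : ℝ) + 1) ≤ (h n ω).re} := by
      rw [Set.ofPred_forall]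
      exact MeasurableSet.iInter fun n => measurableSet_le measurable_const
        (Complex.measurable_re.comp (Lp.stronglyMeasurable (h n)).measurable)
    filter_upwards [eq_zero_iff.1 (D.indic_eq_zero hS hj), ae_indic (μ := μ) hA] with ω h1 h2
    by_contra! hcon
    rw [h2.1 hcon] at h1
    exact one_ne_zero h1
  filter_upwards [ae_all_iff.2 h1] with ω hω ε hε
  obtain ⟨j, hj⟩ := exists_nat_one_div_lt hε
  obtain ⟨n, hn⟩ := hω j
  exact ⟨n, hn.trans hj⟩

end IsDeflation

variable [HilbertKaplanskyModule μ X]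

theorem IsCyclicallyCompact.exists_isDeflation {T : X →ₗ[LInfty μ] X}
    (hT : IsCyclicallyCompact μ T) (hsa : IsSelfAdjointOp μ T) :
    ∃ (S : ℕ → X →ₗ[LInfty μ] X) (h l : ℕ → LInfty μ) (φ : ℕ → X), S 0 = T ∧
      IsDeflation S h l φ := by
  choose h l φ h0 hle hl hll hφ hnφ using
    fun S : {S : X →ₗ[LInfty μ] X // IsCyclicallyCompact μ S ∧ IsSelfAdjointOp μ S} =>
      S.2.1.exists_eigenvector S.2.2
  let F : {S : X →ₗ[LInfty μ] X // IsCyclicallyCompact μ S ∧ IsSelfAdjointOp μ S} →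
      {S : X →ₗ[LInfty μ] X // IsCyclicallyCompact μ S ∧ IsSelfAdjointOp μ S} := fun S =>
    ⟨S.1 - l S • tensor μ (φ S) (φ S),
      S.2.1.sub_smul_tensor (hnφ S ▸ isIdempotentElem_supp _) (hφ S),
      S.2.2.sub_smul_tensor (hl S) (φ S)⟩
  let R := fun n => F^[n] ⟨T, hT, hsa⟩
  refine ⟨fun n => (R n).1, fun n => h (R n), fun n => l (R n), fun n => φ (R n), rfl,
    ⟨fun n => ?_, fun n => (R n).2.2, fun n => h0 _, fun n => hle _, fun n => hl _,
      fun n => hll _, fun n => hφ _, fun n => hnφ _⟩⟩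
  simp only [R, Function.iterate_succ_apply']
  rfl

end Module

/-! ### Level idempotents of a decreasing sequence of idempotents. -/

namespace LInfty

variable {Ω : Type u} [MeasurableSpace Ω] {μ : Measure Ω}

/-- The infimum of a sequence of idempotents. -/
noncomputable def infIdem (P : ℕ → LInfty μ) : LInfty μ := indic {ω | ∀ n, P n ω = 1}

open Classical in
/-- For a decreasing sequence of idempotents `P`, the differences `P k - P (k + 1)` together with
the infimum of the sequence. -/
noncomputable def levels (P : ℕ → LInfty μ) (k : ℕ∞) : LInfty μ :=
  if k = ⊤ then infIdem P else P k.toNat - P (k.toNat + 1)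

theorem levels_top (P : ℕ → LInfty μ) : levels P ⊤ = infIdem P := if_pos rfl

theorem levels_coe (P : ℕ → LInfty μ) (k : ℕ) : levels P k = P k - P (k + 1) := by
  rw [levels, if_neg (ENat.natCast_ne_top k), ENat.toNat_natCast]

open Classical in
-- At almost every point `P n` is `1` up to a last index `κ ≤ ∞` and `0` afterwards, and `levels P
-- k` is the indicator of `κ = k`. All properties of the levels are read off from `κ`.
theorem ae_levels {P : ℕ → LInfty μ} (hP : ∀ n, IsIdempotentElem (P n)) (h0 : P 0 = 1)
    (hmul : ∀ n, P n * P (n + 1) = P (n + 1)) :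
    ∀ᵐ ω ∂μ, ∃ κ : ℕ∞, (∀ k, levels P k ω = if k = κ then 1 else 0) ∧
      ∀ n : ℕ, P n ω = if (n : ℕ∞) ≤ κ then 1 else 0 := by
  have hA : MeasurableSet {ω | ∀ n, P n ω = 1} := by
    rw [Set.ofPred_forall]
    exact MeasurableSet.iInter fun n =>
      (Lp.stronglyMeasurable (P n)).measurable (measurableSet_singleton 1)
  filter_upwards [ae_all_iff.2 fun n => isIdempotentElem_iff_ae.1 (hP n), eq_iff.1 h0,
    ae_one (μ := μ), ae_all_iff.2 fun n => eq_iff.1 (hmul n),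
    ae_all_iff.2 fun n => ae_mul (P n) (P (n + 1)), ae_all_iff.2 fun n => ae_sub (P n) (P (n + 1)),
    ae_indic (μ := μ) hA] with ω h1 h2 h3 h4 h5 h6 h7
  rw [h3] at h2
  have key : ∃ κ : ℕ∞, ∀ n : ℕ, P n ω = if (n : ℕ∞) ≤ κ then 1 else 0 := by
    by_cases hall : ∀ n, P n ω = 1
    · exact ⟨⊤, fun n => by rw [hall, if_pos le_top]⟩
    · push Not at hall
      obtain ⟨m, hm⟩ : ∃ m, Nat.find hall = m + 1 := Nat.exists_eq_succ_of_ne_zero fun h =>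
        Nat.find_spec hall (h ▸ h2)
      refine ⟨m, fun n => ?_⟩
      split_ifs with hn
      · rw [Nat.cast_le] at hn
        by_contra hne
        have := Nat.find_min' hall hne
        omega
      · rw [Nat.cast_le, not_le] at hn
        induction n, hn using Nat.le_induction with
        | base =>
          have := Nat.find_spec hall
          rw [hm] at this
          exact (h1 _).resolve_right this
        | succ n hn ih =>
          rw [← h4, h5, ih, zero_mul]
  obtain ⟨κ, hκ⟩ := key
  refine ⟨κ, fun k => ?_, hκ⟩
  induction k using ENat.recTopCoe with
  | top =>
    rw [levels_top, infIdem]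
    split_ifs with hk
    · exact h7.1 fun n => by rw [hκ, if_pos (hk ▸ le_top)]
    · refine h7.2 fun hall => hk ?_
      refine (ENat.eq_top_iff_forall_ge.2 fun n => ?_).symm
      by_contra hn
      have := hall n
      rw [hκ, if_neg hn] at this
      exact zero_ne_one this
  | coe k =>
    rw [levels_coe, h6, hκ, hκ]
    rcases lt_trichotomy (k : ℕ∞) κ with hk | hk | hk
    · rw [if_pos hk.le, if_pos (by simpa using Order.add_one_le_of_lt hk), if_neg hk.ne, sub_self]
    · rw [← hk, if_pos le_rfl, if_pos rfl, if_neg (by rw [Nat.cast_le]; omega), sub_zero]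
    · rw [if_neg hk.not_ge, if_neg hk.ne', if_neg, sub_self]
      exact fun h => hk.not_ge ((Nat.cast_le.2 k.le_succ).trans h)

theorem isPartitionOfUnity_levels {P : ℕ → LInfty μ} (hP : ∀ n, IsIdempotentElem (P n))
    (h0 : P 0 = 1) (hmul : ∀ n, P n * P (n + 1) = P (n + 1)) : IsPartitionOfUnity (levels P) := by
  have hae := ae_levels hP h0 hmul
  refine ⟨fun k => isIdempotentElem_iff_ae.2 ?_, fun i j hij => eq_zero_iff.2 ?_, fun ρ hρ h => ?_⟩
  · filter_upwards [hae] with ω ⟨κ, hκ, _⟩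
    rw [hκ]
    split_ifs <;> simp
  · filter_upwards [hae, ae_mul (levels P i) (levels P j)] with ω ⟨κ, hκ, _⟩ h1
    rw [h1, hκ, hκ]
    split_ifs with h2 h3
    · exact absurd (h2.trans h3.symm) hij
    all_goals simp
  · rw [eq_iff]
    filter_upwards [hae, ae_all_iff.2 fun i => eq_iff.1 (h i),
      ae_all_iff.2 fun i => ae_mul (levels P i) ρ, ae_one (μ := μ)] with ω ⟨κ, hκ, _⟩ h1 h2 h3
    have h4 := h1 κ
    rw [h2, hκ, if_pos rfl, one_mul] at h4
    rw [h4, h3]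

open Classical in
theorem levels_mul {P : ℕ → LInfty μ} (hP : ∀ n, IsIdempotentElem (P n))
    (h0 : P 0 = 1) (hmul : ∀ n, P n * P (n + 1) = P (n + 1)) (k : ℕ∞) (n : ℕ) :
    levels P k * P n = if (n : ℕ∞) ≤ k then levels P k else 0 := by
  split_ifs with hnk
  · rw [eq_iff]
    filter_upwards [ae_levels hP h0 hmul, ae_mul (levels P k) (P n)] with ω ⟨κ, hκ, hκ'⟩ h1
    rw [h1, hκ, hκ']
    split_ifs with h2 h3
    · simp
    · exact absurd (h2 ▸ hnk) h3
    all_goals simp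
  · rw [eq_zero_iff]
    filter_upwards [ae_levels hP h0 hmul, ae_mul (levels P k) (P n)] with ω ⟨κ, hκ, hκ'⟩ h1
    rw [h1, hκ, hκ']
    split_ifs with h2 h3
    · exact absurd h3 (h2 ▸ hnk)
    all_goals simp

theorem decreasesToZero_of_ae {e : ℕ → LInfty μ} (r : ℕ → Ω → ℝ)
    (he : ∀ n, ∀ᵐ ω ∂μ, e n ω = r n ω) (hr : ∀ᵐ ω ∂μ, ∀ n, 0 ≤ r n ω)
    (hanti : ∀ n, ∀ᵐ ω ∂μ, r (n + 1) ω ≤ r n ω)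
    (hlim : ∀ᵐ ω ∂μ, ∀ ε : ℝ, 0 < ε → ∃ n, r n ω < ε) : DecreasesToZero e := by
  refine ⟨antitone_nat_of_succ_le fun n => ?_, ?_, fun g hg => ?_⟩
  · rw [le_iff]
    filter_upwards [he n, he (n + 1), hanti n] with ω h1 h2 h3
    rw [h1, h2]
    exact_mod_cast h3
  · rintro _ ⟨n, rfl⟩
    rw [nonneg_iff]
    filter_upwards [he n, hr] with ω h1 h2
    rw [h1]
    exact_mod_cast h2 n
  · have h1 : ∀ n, ∀ᵐ ω ∂μ, g ω ≤ e n ω := fun n => le_iff.1 (hg ⟨n, rfl⟩)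
    rw [le_iff]
    filter_upwards [ae_all_iff.2 h1, ae_all_iff.2 he, hlim, Lp.coeFn_zero ℂ ∞ μ] with ω h2 h3 h4 h5
    rw [h5]
    simp only [h3, Complex.le_def, Complex.ofReal_re, Complex.ofReal_im] at h2
    refine Complex.le_def.2 ⟨le_of_forall_pos_le_add fun ε hε => ?_, (h2 0).2⟩
    obtain ⟨n, hn⟩ := h4 ε hε
    simpa using (h2 n).1.trans hn.le

end LInfty

/-! ### Order sums on the infinite and the finite levels. -/

section Module

variable {Ω : Type u} [MeasurableSpace Ω] {μ : Measure Ω} {X : Type v} [AddCommGroup X]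
  [Module (LInfty μ) X] [LInftyInner μ X]

theorem vnorm_le_of_nsq_le {ξ η : X} {m : LInfty μ} (hm : 0 ≤ m)
    (h : nsq μ ξ ≤ m * m * nsq μ η) : vnorm μ ξ ≤ m * vnorm μ η :=
  sqrt_le_mul_sqrt (nsq_nonneg ξ) (nsq_nonneg η) hm h

theorem smul_tensor_smul {p : LInfty μ} (hp : IsIdempotentElem p) (l : LInfty μ) (φ : X) :
    (p * l) • tensor μ (p • φ) (p • φ) = p • l • tensor μ φ φ := by
  ext ζ
  simp only [LinearMap.smul_apply, tensor_apply, inner_smul_right, star_of_isIdempotentElem hp,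
    smul_smul]
  congr 1
  linear_combination (l * inner μ ζ φ * (p + 1)) * hp.eq

/-- The idempotents on which at least `n` eigenvectors are nonzero. -/
noncomputable def supports (h : ℕ → LInfty μ) : ℕ → LInfty μ
  | 0 => 1
  | n + 1 => supp (h n)

theorem isIdempotentElem_supports (h : ℕ → LInfty μ) : ∀ n, IsIdempotentElem (supports h n)
  | 0 => IsIdempotentElem.one
  | n + 1 => isIdempotentElem_supp (h n)

namespace IsDeflation

variable {S : ℕ → X →ₗ[LInfty μ] X} {h l : ℕ → LInfty μ} {φ : ℕ → X}

theorem supports_mul_succ (D : IsDeflation S h l φ) :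
    ∀ n, supports h n * supports h (n + 1) = supports h (n + 1)
  | 0 => one_mul _
  | n + 1 => D.supp_mul_supp_succ n

theorem isPartitionOfUnity (D : IsDeflation S h l φ) : IsPartitionOfUnity (levels (supports h)) :=
  isPartitionOfUnity_levels (isIdempotentElem_supports h) rfl D.supports_mul_succ

theorem levels_mul_supp (D : IsDeflation S h l φ) {k : ℕ∞} {n : ℕ} (hn : ((n + 1 : ℕ) : ℕ∞) ≤ k) :
    levels (supports h) k * supp (h n) = levels (supports h) k := by
  have := levels_mul (isIdempotentElem_supports h) rfl D.supports_mul_succ k (n + 1)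
  rwa [if_pos hn] at this

/-- `h k` vanishes on level `k` and bounds `S k`. The case `k = 0` yields `π 0 • T = 0`. -/
theorem levels_smul_eq_zero (D : IsDeflation S h l φ) (k : ℕ) :
    levels (supports h) k • S k = 0 := by
  refine D.smul_eq_zero (D.isPartitionOfUnity.1 _) ?_
  have := levels_mul (isIdempotentElem_supports h) rfl D.supports_mul_succ k (k + 1)
  rwa [if_neg (by rw [Nat.cast_le]; omega)] at this

theorem levels_smul_sum (D : IsDeflation S h l φ) (k : ℕ) :
    levels (supports h) k • ∑ i ∈ Finset.range k, l i • tensor μ (φ i) (φ i) =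
      levels (supports h) k • S 0 := by
  conv_rhs => rw [D.eq_add_sum k, smul_add, D.levels_smul_eq_zero, zero_add]

theorem ae_sqrt_antitone (D : IsDeflation S h l φ) (n : ℕ) :
    ∀ᵐ ω ∂μ, √(h (n + 1) ω).re ≤ √(h n ω).re := by
  filter_upwards [le_iff.1 (D.antitone n.le_succ)] with ω h1
  exact Real.sqrt_le_sqrt (Complex.le_def.1 h1).1

theorem ae_top_mul_abs (D : IsDeflation S h l φ) (n : ℕ) :
    ∀ᵐ ω ∂μ, (levels (supports h) ⊤ * LInfty.abs (levels (supports h) ⊤ * l n) : LInfty μ) ω =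
      ((‖levels (supports h) ⊤ ω‖ * √(h n ω).re : ℝ) : ℂ) := by
  filter_upwards [isIdempotentElem_iff_ae.1 (D.isPartitionOfUnity.1 ⊤), D.ae_norm n,
    ae_mul (levels (supports h) ⊤) (LInfty.abs (levels (supports h) ⊤ * l n)),
    ae_abs (levels (supports h) ⊤ * l n), ae_mul (levels (supports h) ⊤) (l n)]
    with ω h1 h2 h3 h4 h5
  rw [h3, h4, h5]
  rcases h1 with h1 | h1 <;> simp [h1, h2]

/-- This identifies `π ⊤ * |f|` as the square root of `π ⊤ * h n`, the bound on the squared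
remainder in `hasOrderSum_top`. -/
theorem top_mul_abs_mul_self (D : IsDeflation S h l φ) (n : ℕ) :
    levels (supports h) ⊤ * LInfty.abs (levels (supports h) ⊤ * l n) *
      (levels (supports h) ⊤ * LInfty.abs (levels (supports h) ⊤ * l n)) =
      levels (supports h) ⊤ * h n := by
  set e := levels (supports h) ⊤ * LInfty.abs (levels (supports h) ⊤ * l n) with he
  rw [eq_iff]
  filter_upwards [D.ae_top_mul_abs n, ae_mul e e, ae_mul (levels (supports h) ⊤) (h n),
    isIdempotentElem_iff_ae.1 (D.isPartitionOfUnity.1 ⊤), nonneg_iff.1 (D.nonneg n)]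
    with ω h1 h2 h3 h4 h5
  rw [h2, h3, h1]
  rcases h4 with h4 | h4
  · simp [h4]
  · rw [h4, norm_one, one_mul, one_mul, ← Complex.ofReal_mul,
      Real.mul_self_sqrt (Complex.nonneg_iff.1 h5).1]
    exact Complex.ext rfl (Complex.nonneg_iff.1 h5).2

theorem decreasesToZero_top [HilbertKaplanskyModule μ X] (D : IsDeflation S h l φ)
    (hS : IsCyclicallyCompact μ (S 0)) :
    DecreasesToZero fun n => levels (supports h) ⊤ * LInfty.abs (levels (supports h) ⊤ * l n) := by
  refine decreasesToZero_of_ae (fun n ω => ‖levels (supports h) ⊤ ω‖ * √(h n ω).re)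
    D.ae_top_mul_abs (Filter.Eventually.of_forall fun ω n => by positivity) (fun n => ?_) ?_
  · filter_upwards [D.ae_sqrt_antitone n] with ω h1
    exact mul_le_mul_of_nonneg_left h1 (norm_nonneg _)
  · filter_upwards [D.ae_exists_lt hS, isIdempotentElem_iff_ae.1 (D.isPartitionOfUnity.1 ⊤)]
      with ω h1 h2 ε hε
    obtain ⟨n, hn⟩ := h1 (ε ^ 2) (by positivity)
    refine ⟨n, ?_⟩
    rcases h2 with h2 | h2
    · simpa [h2] using hε
    · rw [h2, norm_one, one_mul]
      exact (Real.sqrt_lt' hε).2 hn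

theorem hasOrderSum_top [HilbertKaplanskyModule μ X] (D : IsDeflation S h l φ)
    (hS : IsCyclicallyCompact μ (S 0)) :
    HasOrderSum μ (fun n => (levels (supports h) ⊤ * l n) •
      tensor μ (levels (supports h) ⊤ • φ n) (levels (supports h) ⊤ • φ n))
      (levels (supports h) ⊤ • S 0) := by
  have hp := D.isPartitionOfUnity.1 ⊤
  have hd := D.decreasesToZero_top hS
  refine ⟨_, hd, fun N ζ => vnorm_le_of_nsq_le (hd.2.1 ⟨N, rfl⟩) ?_⟩
  simp only [smul_tensor_smul hp]
  -- The remainder after `N` terms is exactly `π ⊤ • S N`.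
  rw [← Finset.smul_sum, ← LinearMap.sub_apply, ← smul_sub, D.eq_add_sum N, add_sub_cancel_right,
    LinearMap.smul_apply, nsq_smul_of_isIdempotentElem hp, D.top_mul_abs_mul_self, mul_assoc]
  exact mul_le_mul_of_nonneg_left (D.nsq_map_le N ζ) (nonneg_of_isIdempotentElem hp)

theorem levels_smul_sum_tensor (D : IsDeflation S h l φ) (k : ℕ) :
    levels (supports h) k • ∑ n ∈ Finset.Icc 1 k, (levels (supports h) k * l (n - 1)) •
      tensor μ (levels (supports h) k • φ (n - 1)) (levels (supports h) k • φ (n - 1)) =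
      levels (supports h) k • S 0 := by
  have hp := D.isPartitionOfUnity.1 k
  simp only [smul_tensor_smul hp]
  rw [← Finset.smul_sum, smul_smul, hp.eq, ← D.levels_smul_sum k]
  congr 1
  rw [Finset.range_eq_Ico, Finset.sum_Ico_eq_sum_range, ← Finset.Ico_add_one_right_eq_Icc,
    Finset.sum_Ico_eq_sum_range]
  simp

open Classical in
-- The levels telescope, so the remainder after `N` terms is `p N • S 0`, where `p N` is the region
-- `N < κ < ∞`. These regions shrink to nothing, hence `p N * √(h 0)` decreases to `0`, though not
-- necessarily in norm.
theorem hasOrderSum_finite (D : IsDeflation S h l φ) :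
    HasOrderSum μ (fun j : ℕ => levels (supports h) ((j + 1 : ℕ) : ℕ∞) • S 0)
      (S 0 - levels (supports h) ⊤ • S 0) := by
  have hae := ae_levels (isIdempotentElem_supports h) rfl D.supports_mul_succ
  set p := fun N => supports h (N + 1) - levels (supports h) ⊤ with hpdef
  have hpae : ∀ᵐ ω ∂μ, ∃ κ : ℕ∞, ∀ N, p N ω = if κ ≠ ⊤ ∧ ((N + 1 : ℕ) : ℕ∞) ≤ κ then 1 else 0 := by
    filter_upwards [hae, ae_all_iff.2 fun N : ℕ =>
      ae_sub (supports h (N + 1)) (levels (supports h) ⊤)] with ω ⟨κ, h1, h2⟩ h3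
    refine ⟨κ, fun N => ?_⟩
    rw [h3, h1, h2]
    by_cases hκ : κ = ⊤
    · simp [hκ]
    · rw [if_neg (Ne.symm hκ)]
      simp [hκ]
  have hp : ∀ N, IsIdempotentElem (p N) := fun N => by
    rw [isIdempotentElem_iff_ae]
    filter_upwards [hpae] with ω ⟨κ, h1⟩
    rw [h1]
    split_ifs <;> simp
  refine ⟨fun N => p N * sqrt (h 0), ?_, fun N ζ => vnorm_le_of_nsq_le
    (mul_nonneg (nonneg_of_isIdempotentElem (hp N)) (sqrt_nonneg _)) ?_⟩
  · refine decreasesToZero_of_ae (fun n ω => ‖p n ω‖ * √(h 0 ω).re) (fun n => ?_)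
      (Filter.Eventually.of_forall fun ω n => by positivity) (fun n => ?_) ?_
    · filter_upwards [isIdempotentElem_iff_ae.1 (hp n), ae_mul (p n) (sqrt (h 0)), ae_sqrt (h 0)]
        with ω h1 h2 h3
      rw [h2, h3]
      rcases h1 with h1 | h1 <;> simp [h1]
    · filter_upwards [hpae] with ω ⟨κ, h1⟩
      refine mul_le_mul_of_nonneg_right ?_ (Real.sqrt_nonneg _)
      rw [h1, h1]
      split_ifs with h2 h3
      · exact le_rfl
      · exact absurd ⟨h2.1, (Nat.cast_le.2 (n + 1).le_succ).trans h2.2⟩ h3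
      all_goals simp
    · filter_upwards [hpae] with ω ⟨κ, h1⟩ ε hε
      induction κ using ENat.recTopCoe with
      | top => exact ⟨0, by simpa [h1] using hε⟩
      | coe k =>
        refine ⟨k, ?_⟩
        rw [h1, if_neg fun h2 => by
          have := h2.2
          rw [Nat.cast_le] at this
          omega]
        simpa using hε
  · have h0 : supports h 1 • S 0 = S 0 := by
      have := D.levels_smul_eq_zero 0
      rw [levels_coe, sub_smul, sub_eq_zero] at this
      exact this.symm.trans (one_smul _ _)
    have hsum : ∑ j ∈ Finset.range N, levels (supports h) ((j + 1 : ℕ) : ℕ∞) =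
        supports h 1 - supports h (N + 1) := by
      simp only [levels_coe]
      exact Finset.sum_range_sub' (fun j => supports h (j + 1)) N
    have hres : S 0 - levels (supports h) ⊤ • S 0 -
        ∑ j ∈ Finset.range N, levels (supports h) ((j + 1 : ℕ) : ℕ∞) • S 0 = p N • S 0 := by
      rw [← Finset.sum_smul, hsum, sub_smul, h0, hpdef, sub_smul]
      abel
    rw [← LinearMap.sub_apply, hres, LinearMap.smul_apply, nsq_smul_of_isIdempotentElem (hp N)]
    refine (mul_le_mul_of_nonneg_left (D.nsq_map_le 0 ζ) (nonneg_of_isIdempotentElem (hp N))).trans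
      (le_of_eq ?_)
    linear_combination (-(sqrt (h 0) * sqrt (h 0) * nsq μ ζ)) * (hp N).eq -
      p N * nsq μ ζ * sqrt_mul_sqrt (D.nonneg 0)

end IsDeflation

end Module

end CyclicSpectral

/-! ### Assembly of the decomposition. -/

theorem theorem2p1 {Ω : Type u} [MeasurableSpace Ω] (μ : Measure Ω)
    (hμ : CyclicSpectral.HasDirectSumProperty μ)
    (X : Type v) [AddCommGroup X] [Module (CyclicSpectral.LInfty μ) X]
    [CyclicSpectral.LInftyInner μ X] [CyclicSpectral.HilbertKaplanskyModule μ X]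
    (T : X →ₗ[CyclicSpectral.LInfty μ] X)
    (hT : CyclicSpectral.IsCyclicallyCompact μ T)
    (hsa : CyclicSpectral.IsSelfAdjointOp μ T) :
    ∃ (π : ℕ∞ → CyclicSpectral.LInfty μ) (ξ : ℕ∞ → ℕ → X)
      (f : ℕ∞ → ℕ → CyclicSpectral.LInfty μ),
      CyclicSpectral.LInfty.IsPartitionOfUnity π ∧
      -- each `ξ k n`, for `1 ≤ n ≤ k`, lies in `π k X`, and these families are orthonormal there
      (∀ (k : ℕ∞) (n : ℕ), 1 ≤ n → (n : ℕ∞) ≤ k → π k • ξ k n = ξ k n) ∧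
      (∀ (k : ℕ∞) (m n : ℕ), 1 ≤ m → (m : ℕ∞) ≤ k → 1 ≤ n → (n : ℕ∞) ≤ k →
        CyclicSpectral.inner μ (ξ k m) (ξ k n) = if m = n then π k else 0) ∧
      -- each `f k n`, for `1 ≤ n ≤ k`, lies in `π k L^∞(Ω)`
      (∀ (k : ℕ∞) (n : ℕ), 1 ≤ n → (n : ℕ∞) ≤ k → π k * f k n = f k n) ∧
      π 0 • T = 0 ∧
      CyclicSpectral.LInfty.DecreasesToZero
        (fun n : ℕ => π ⊤ * CyclicSpectral.LInfty.abs (f ⊤ (n + 1))) ∧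
      ∃ Tinf Tfin : X →ₗ[CyclicSpectral.LInfty μ] X,
        CyclicSpectral.HasOrderSum μ
          (fun n : ℕ => f ⊤ (n + 1) • CyclicSpectral.tensor μ (ξ ⊤ (n + 1)) (ξ ⊤ (n + 1))) Tinf ∧
        CyclicSpectral.HasOrderSum μ
          (fun j : ℕ => π ((j + 1 : ℕ) : ℕ∞) •
            ∑ n ∈ Finset.Icc 1 (j + 1), f ((j + 1 : ℕ) : ℕ∞) n •
              CyclicSpectral.tensor μ (ξ ((j + 1 : ℕ) : ℕ∞) n) (ξ ((j + 1 : ℕ) : ℕ∞) n)) Tfin ∧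
        T = π ⊤ • Tinf + Tfin := by
  obtain ⟨S, h, l, φ, rfl, D⟩ := hT.exists_isDeflation hsa
  have hp := D.isPartitionOfUnity.1
  have hpred : ∀ {n : ℕ}, 1 ≤ n → n - 1 + 1 = n := fun hn => Nat.sub_add_cancel hn
  -- The deflation is indexed from `0` and the statement from `1`, hence `n - 1`; the entries at `n
  -- = 0` play no role. The infinite part already carries `π ⊤`, so multiplying by it again changes
  -- nothing.
  refine ⟨CyclicSpectral.LInfty.levels (CyclicSpectral.supports h),
    fun k n => CyclicSpectral.LInfty.levels (CyclicSpectral.supports h) k • φ (n - 1),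
    fun k n => CyclicSpectral.LInfty.levels (CyclicSpectral.supports h) k * l (n - 1),
    D.isPartitionOfUnity, fun k n _ _ => by rw [smul_smul, (hp k).eq], fun k m n hm _ hn hnk => ?_,
    fun k n _ _ => by rw [← mul_assoc, (hp k).eq], ?_, D.decreasesToZero_top hT,
    CyclicSpectral.LInfty.levels (CyclicSpectral.supports h) ⊤ • S 0,
    S 0 - CyclicSpectral.LInfty.levels (CyclicSpectral.supports h) ⊤ • S 0,
    D.hasOrderSum_top hT, ?_, ?_⟩
  · rw [CyclicSpectral.inner_smul_left, CyclicSpectral.inner_smul_right,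
      CyclicSpectral.LInfty.star_of_isIdempotentElem (hp k), ← mul_assoc, (hp k).eq]
    split_ifs with hmn
    · subst hmn
      exact (congrArg _ (D.nsq_eq (m - 1))).trans (D.levels_mul_supp (by rwa [hpred hm]))
    · rw [D.inner_eq_zero (by omega), mul_zero]
  · exact D.levels_smul_eq_zero 0
  · simp only [D.levels_smul_sum_tensor]
    exact D.hasOrderSum_finite
  · rw [smul_smul, (hp ⊤).eq, add_sub_cancel]
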